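/- For a transcendental real number $\zeta$ and an integer $n\ge 1$, let $w_n(\zeta)\in[0,\infty]$ be the supremum of the real numbers $w$ such that $0<|P(\zeta)|\le H(P)^{-w}$ has infinitely many solutions $P\in\mathbb{Z}[T]$ of degree at most $n$, where $H(P)$ is the maximum modulus of the coefficients of $P$. For $1\le j\le n+1$ let $\lambda_{n,j}(\zeta)$ be the supremum of the real numbers $\lambda$ such that the system $$1\le |x|\le X,\qquad \max_{1\le i\le n}|\zeta^i x-y_i|\le X^{-\lambda}$$ has $j$ linearly independent solutions $(x,y_1,\dots,y_n)\in\mathbb{Z}^{n+1}$ for arbitrarily large $X$, and put $\lambda_n(\zeta)=\lambda_{n,1}(\zeta)$. A transcendental real number $\zeta$ is a $U_m$-number if $w_m(\zeta)=\infty$ and $m\ge 1$ is the smallest such index. **Theorem.** Let $m\ge 2$ be an integer and let $\zeta$ be a $U_m$-number. (a) $\lambda_n(\zeta)\ge \frac{1}{m-1}$ for all $n\ge 1$. (b) One has $w_{m-1}(\zeta)=m-1$ if and only if $$\lambda_n(\zeta)=\lambda_{n,2}(\zeta)=\cdots=\lambda_{n,m}(\zeta)=\frac{1}{m-1}\qquad\text{for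 all } n\ge m-1.$$ (c) Let $w\in[-\infty,\infty]$, and if $m=2$ assume $w\in[1,2]$. Then $$w_1(\zeta)=w\in[1,2]\quad\text{and}\quad w_t(\zeta)=t\ \text{ for all } 2\le t\le m-1$$ hold if and only if $$\lambda_1(\zeta)=w,\qquad \lambda_n(\zeta)=\frac1n\ \ (2\le n\le m-1),\qquad \lambda_n(\zeta)=\frac{1}{m-1}\ \ (n\ge \max\{2,m-1\}),$$ that is, if and only if $(\lambda_n(\zeta))_{n\ge1}=\left(w,\frac12,\frac13,\dots,\frac1{m-2},\frac1{m-1},\frac1{m-1},\dots\right)$. -/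

import Mathlib

open Polynomial Filter

/-- The height `H(P)`: the maximum modulus of the coefficients of an integer polynomial
(equal to `0` for `P = 0`). -/
noncomputable def polyHeight (P : ℤ[X]) : ℕ :=
  P.support.sup fun i => (P.coeff i).natAbs

/-- The exponent `w_n(ζ)`: the supremum, in the extended reals, of the real numbers `w` such that
`0 < |P(ζ)| ≤ H(P)^(-w)` has infinitely many solutions `P ∈ ℤ[T]` of degree at most `n`. -/
noncomputable def wExponent (n : ℕ) (ζ : ℝ) : EReal :=
  sSup ((fun w : ℝ => (w : EReal)) ''
    {w : ℝ | {P : ℤ[X] | P.natDegree ≤ n ∧ 0 < |aeval ζ P| ∧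
      |aeval ζ P| ≤ (polyHeight P : ℝ) ^ (-w)}.Infinite})

/-- The integer vector `v = (x, y₁, …, yₙ)` solves the system
`1 ≤ |x| ≤ X`, `|ζ ^ i * x - yᵢ| ≤ X ^ (-lam)` for `1 ≤ i ≤ n`. -/
def IsSimulSolution (n : ℕ) (ζ lam X : ℝ) (v : Fin (n + 1) → ℤ) : Prop :=
  1 ≤ |(v 0 : ℝ)| ∧ |(v 0 : ℝ)| ≤ X ∧
    ∀ i : Fin n, |ζ ^ ((i : ℕ) + 1) * (v 0 : ℝ) - (v i.succ : ℝ)| ≤ X ^ (-lam)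

/-- The exponent `λ_n(ζ)`: the supremum, in the extended reals, of the real numbers `lam` such that
the system has an integer solution for arbitrarily large `X`. -/
noncomputable def lambdaExponent (n : ℕ) (ζ : ℝ) : EReal :=
  sSup ((fun lam : ℝ => (lam : EReal)) ''
    {lam : ℝ | ∃ᶠ X : ℝ in atTop, ∃ v : Fin (n + 1) → ℤ, IsSimulSolution n ζ lam X v})

/-- The successive minima exponent `λ_{n,j}(ζ)`: the supremum, in the extended reals, of the real
numbers `lam` such that the system has `j` linearly independent integer solutions for arbitrarily
large `X`. -/
noncomputable def lambdaMinExponent (n j : ℕ) (ζ : ℝ) : EReal :=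
  sSup ((fun lam : ℝ => (lam : EReal)) ''
    {lam : ℝ | ∃ᶠ X : ℝ in atTop, ∃ v : Fin j → Fin (n + 1) → ℤ,
      LinearIndependent ℤ v ∧ ∀ k : Fin j, IsSimulSolution n ζ lam X (v k)})

/-- `ζ` is a `U_m`-number: a transcendental real number such that `m` is the smallest index
`≥ 1` with `w_m(ζ) = ∞`. -/
structure IsUNumber (m : ℕ) (ζ : ℝ) : Prop where
  transcendental : Transcendental ℚ ζ
  one_le : 1 ≤ m
  eq_top : wExponent m ζ = ⊤
  ne_top : ∀ k : ℕ, 1 ≤ k → k < m → wExponent k ζ ≠ ⊤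

/-!
Write `m = d + 1`. Everything rests on two mechanisms.

*Geometry of numbers.* Minkowski's linear forms theorem is used in the variant
`exists_int_abs_sum_le`, where one form of a system is traded for a linear combination of all of
them. Taking for the combination an integral form, which vanishes as soon as it is smaller than `1`,
gives both halves of Khintchine's transference principle (`mem_wSet_of_mem_simulSet`,
`mem_simulSet_of_mem_wSet`). Hence `λ_1(ζ) = w_1(ζ)` and `w_n(ζ) = n ↔ λ_n(ζ) = 1 / n`. Taking for
it a form vanishing on a hyperplane that contains all small integer vectors gives a weak version of
Minkowski's second theorem: if `λ_n(ζ) = 1 / n`, then at every scale there are `n + 1` linearly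
independent simultaneous approximations of nearly optimal quality
(`exists_linearIndependent_of_lambdaExponent_le`).

*Almost recurrences.* A `U`-number of index `d + 1` admits integer polynomials `P` of degree exactly
`d + 1` with `|P(ζ)|` smaller than any prescribed power of the height, so up to a negligible error
the powers of `ζ` satisfy a linear recurrence of order `d + 1`. Multiplying an integer vector that
approximates `(1, ζ, …, ζ ^ d)` by a power of the leading coefficient of `P`, one can prolong it by
the recurrence to a vector for `(1, ζ, …, ζ ^ n)` (`exists_extension`). If the scale of the vector
is a large power of `H(P)`, the factors lost do not affect the exponent, and linear independence is
kept. So solutions of quality `1 / d` for the first `d` powers, available at every scale, are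
inherited by all `n ≥ d` (`IsUNumber.one_div_le_lambdaMinExponent`). Applied to Dirichlet's
theorem this is the lower bound `λ_n(ζ) ≥ 1 / d`; applied to independent families it yields the
successive minima exponents.

The matching upper bounds come from the transference principle and the monotonicity of `λ_n` in `n`.
Only for `m = 2` is another argument needed, namely that `w_1(ζ) ≤ 2` forces `λ_2(ζ) ≤ 1`
(`five_halves_mem_wSet_one`).
-/

/-! ### Geometry of numbers -/

/-- Minkowski's linear forms theorem, with a strict inequality on the determinant. -/
theorem exists_int_abs_mulVec_le {ι : Type*} [Fintype ι] [DecidableEq ι] (M : Matrix ι ι ℝ)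
    (hM : M.det ≠ 0) (c : ι → ℝ) (hc : ∀ i, 0 < c i) (h : |M.det| < ∏ i, c i) :
    ∃ z : ι → ℤ, z ≠ 0 ∧ ∀ i, |M.mulVec (fun k => (z k : ℝ)) i| ≤ c i := by
  set b := Pi.basisFun ℝ ι
  set B : Set (ι → ℝ) := Set.univ.pi fun i => Set.Ioo (-c i) (c i) with hB
  have hdet : LinearMap.det (Matrix.toLin' M) ≠ 0 := by rwa [LinearMap.det_toLin']
  have hvol : MeasureTheory.volume (Matrix.toLin' M ⁻¹' B)
      = ENNReal.ofReal (|M.det|⁻¹ * (2 ^ Fintype.card ι * ∏ i, c i)) := by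
    rw [MeasureTheory.Measure.addHaar_preimage_linearMap _ hdet, LinearMap.det_toLin', hB,
      Real.volume_pi_Ioo, ← ENNReal.ofReal_prod_of_nonneg (fun i _ => by linarith [hc i]),
      ← ENNReal.ofReal_mul (abs_nonneg _), abs_inv]
    congr 2
    rw [Finset.prod_congr rfl (fun i _ => show c i - -c i = 2 * c i by ring),
      Finset.prod_mul_distrib]
    simp
  have hfund : MeasureTheory.volume (ZSpan.fundamentalDomain b) = 1 := by
    rw [ZSpan.fundamentalDomain_pi_basisFun, Real.volume_pi_Ico]
    simp
  have hpos : 0 < |M.det| := abs_pos.2 hM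
  have hlt : MeasureTheory.volume (ZSpan.fundamentalDomain b)
      * 2 ^ Module.finrank ℝ (ι → ℝ) < MeasureTheory.volume (Matrix.toLin' M ⁻¹' B) := by
    rw [hfund, one_mul, hvol, Module.finrank_fintype_fun_eq_card,
      show (2 : ENNReal) ^ Fintype.card ι = ENNReal.ofReal (2 ^ Fintype.card ι) by
        rw [ENNReal.ofReal_pow (by norm_num)]; norm_num]
    rw [ENNReal.ofReal_lt_ofReal_iff_of_nonneg (by positivity), lt_inv_mul_iff₀ hpos, mul_comm]
    exact mul_lt_mul_of_pos_left h (by positivity)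
  have hconv : Convex ℝ (Matrix.toLin' M ⁻¹' B) :=
    (convex_pi fun i _ => convex_Ioo _ _).linear_preimage _
  have hsymm : ∀ x ∈ Matrix.toLin' M ⁻¹' B, -x ∈ Matrix.toLin' M ⁻¹' B := by
    intro x hx
    simp only [hB, Set.mem_preimage, Set.mem_univ_pi, Set.mem_Ioo, map_neg, Pi.neg_apply] at hx ⊢
    exact fun i => ⟨by linarith [(hx i).2], by linarith [(hx i).1]⟩
  have : Countable (Submodule.span ℤ (Set.range b)).toAddSubgroup :=
    inferInstanceAs (Countable (Submodule.span ℤ (Set.range b)))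
  obtain ⟨x, hx0, hx⟩ := MeasureTheory.exists_ne_zero_mem_lattice_of_measure_mul_two_pow_lt_measure
    (ZSpan.isAddFundamentalDomain' b MeasureTheory.volume) hsymm hconv hlt
  have hmem := (b.mem_span_iff_repr_mem ℤ (x : ι → ℝ)).1 x.2
  choose z hz using hmem
  have hz' : (fun k => (z k : ℝ)) = (x : ι → ℝ) := by
    funext k
    have := hz k
    simpa [b] using this
  refine ⟨z, ?_, fun i => ?_⟩
  · rintro rfl
    apply hx0
    ext k
    simp [← hz']
  · rw [hz']
    simp only [hB, Set.mem_preimage, Set.mem_univ_pi, Set.mem_Ioo, Matrix.toLin'_apply] at hx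
    exact abs_le.2 ⟨(hx i).1.le, (hx i).2.le⟩

/-- Minkowski's linear forms theorem after trading one of the linear forms for a linear
combination of all of them. -/
theorem exists_int_abs_sum_le {ι : Type*} [Fintype ι] [DecidableEq ι] (M : Matrix ι ι ℝ)
    (hM : M.det ≠ 0) (c : ι → ℝ) (i₀ : ι) (hc : c i₀ ≠ 0) (b : ι → ℝ) (hb : ∀ i, 0 < b i)
    (h : |c i₀| * |M.det| < ∏ i, b i) :
    ∃ z : ι → ℤ, z ≠ 0 ∧ |∑ k, c k * M.mulVec (fun k => (z k : ℝ)) k| ≤ b i₀ ∧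
      ∀ i, i ≠ i₀ → |M.mulVec (fun k => (z k : ℝ)) i| ≤ b i := by
  have hdet : (M.updateRow i₀ (∑ k, c k • M k)).det = c i₀ * M.det := by
    rw [Matrix.det_updateRow_sum, smul_eq_mul]
  obtain ⟨z, hz, hzb⟩ := exists_int_abs_mulVec_le (M.updateRow i₀ (∑ k, c k • M k))
    (by rw [hdet]; exact mul_ne_zero hc hM) b hb (by rwa [hdet, abs_mul])
  refine ⟨z, hz, ?_, fun i hi => ?_⟩
  · have := hzb i₀
    rw [Matrix.mulVec, Matrix.updateRow_self, sum_dotProduct] at this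
    simp only [smul_dotProduct, smul_eq_mul] at this
    exact this
  · have := hzb i
    rwa [Matrix.mulVec, Matrix.updateRow_ne hi] at this

/-- A weak form of Minkowski's second theorem: if no nonzero integer vector is small for the
linear forms `M`, then linearly independent integer vectors of controlled size exist. Otherwise
all integer vectors of that size lie in a hyperplane, and a parallelepiped that is thin in all
directions but the one across this hyperplane contains a nonzero integer vector; that vector is on
the hyperplane, hence small in every direction. -/
theorem exists_linearIndependent_abs_mulVec_le {ι : Type*} [Fintype ι] [DecidableEq ι]
    [Nonempty ι] (M : Matrix ι ι ℝ) (hM : M.det ≠ 0) {r ρ R' R : ℝ}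
    (hr : ∀ z : ι → ℤ, z ≠ 0 → ∃ i, r ≤ |M.mulVec (fun k => (z k : ℝ)) i|)
    (hρ : 0 < ρ) (hρr : Fintype.card ι * ρ < r) (hR' : 0 < R')
    (h : |M.det| < R' * ρ ^ (Fintype.card ι - 1)) (hR : R' + Fintype.card ι * ρ ≤ R) :
    ∃ v : ι → ι → ℤ, LinearIndependent ℤ v ∧
      ∀ k i, |M.mulVec (fun l => (v k l : ℝ)) i| ≤ R := by
  have hcard : 1 ≤ (Fintype.card ι : ℝ) := by exact_mod_cast Fintype.card_pos
  set S : Set (ι → ℝ) := {x | (∃ z : ι → ℤ, (fun l => (z l : ℝ)) = x) ∧ ∀ i, |M.mulVec x i| ≤ R}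
    with hS
  by_cases htop : Submodule.span ℝ S = ⊤
  · obtain ⟨b, hbS, hbspan, hbli⟩ := exists_linearIndependent ℝ S
    rw [htop] at hbspan
    have hB : ⊤ ≤ Submodule.span ℝ (Set.range ((↑) : b → ι → ℝ)) := by
      rw [Subtype.range_coe, hbspan]
    set bas := Module.Basis.mk hbli hB
    have : Fintype b := FiniteDimensional.fintypeBasisIndex bas
    have e : ι ≃ b := (Pi.basisFun ℝ ι).indexEquiv bas
    choose v hv using fun k : ι => (hbS (e k).2).1
    refine ⟨v, ?_, fun k i => ?_⟩
    · have h1 : LinearIndependent ℝ fun k : ι => ((e k : b) : ι → ℝ) := hbli.comp e e.injective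
      have h2 : LinearIndependent ℤ fun k : ι => ((e k : b) : ι → ℝ) :=
        h1.restrict_scalars (by intro a b hab; simpa using hab)
      let f : (ι → ℤ) →ₗ[ℤ] (ι → ℝ) :=
        { toFun := fun z l => (z l : ℝ)
          map_add' := by intro x y; ext; simp
          map_smul' := by intro x y; ext; simp }
      refine LinearIndependent.of_comp f ?_
      convert h2 using 2 with k
      exact hv k
    · rw [hv k]
      exact (hbS (e k).2).2 i
  · exfalso
    obtain ⟨φ, hφ0, hφ⟩ := Submodule.exists_le_ker_of_lt_top _ (lt_top_iff_ne_top.2 htop)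
    set d : ι → ℝ := fun i => φ (Pi.single i 1)
    have hφd : ∀ x, φ x = d ⬝ᵥ x := by
      intro x
      rw [LinearMap.pi_apply_eq_sum_univ φ x]
      simp only [dotProduct, d, smul_eq_mul]
      refine Finset.sum_congr rfl fun i _ => ?_
      rw [mul_comm]
      congr 2
      ext j
      simp [Pi.single_apply, eq_comm]
    set c := Matrix.vecMul d M⁻¹ with hc
    have hcφ : ∀ x, ∑ k, c k * M.mulVec x k = φ x := by
      intro x
      have : ∑ k, c k * M.mulVec x k = c ⬝ᵥ M.mulVec x := rfl
      rw [this, hc, ← Matrix.dotProduct_mulVec, Matrix.mulVec_mulVec,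
        Matrix.nonsing_inv_mul _ (isUnit_iff_ne_zero.2 hM), Matrix.one_mulVec, hφd]
    obtain ⟨i₀, hi₀⟩ := Finite.exists_max fun i => |c i|
    have hci₀ : c i₀ ≠ 0 := by
      intro h0
      apply hφ0
      ext1 x
      have hcz : ∀ i, c i = 0 := fun i => by
        have := hi₀ i
        rw [h0, abs_zero] at this
        exact abs_nonpos_iff.1 this
      ext
      simp [← hcφ, hcz]
    have hcpos : 0 < |c i₀| := abs_pos.2 hci₀
    obtain ⟨z, hz0, hz1, hz2⟩ := exists_int_abs_sum_le M hM c i₀ hci₀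
      (Function.update (fun _ => ρ) i₀ (|c i₀| * R'))
      (fun i => by
        by_cases hi : i = i₀
        · subst hi; simp only [Function.update_self]; positivity
        · simpa [Function.update_of_ne hi] using hρ) (by
        rw [Finset.prod_update_of_mem (Finset.mem_univ _), Finset.prod_const,
          Finset.card_sdiff_of_subset (by simp), Finset.card_univ, Finset.card_singleton, mul_assoc]
        exact mul_lt_mul_of_pos_left h hcpos)
    set y := M.mulVec fun k => (z k : ℝ) with hy
    rw [Function.update_self] at hz1
    have hz2' : ∀ i, i ≠ i₀ → |y i| ≤ ρ := fun i hi => by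
      simpa [Function.update_of_ne hi] using hz2 i hi
    -- the remaining coordinate is controlled by the linear combination, as `|c i₀|` is maximal
    have key : ∀ t, |∑ k, c k * y k| ≤ |c i₀| * t → |y i₀| ≤ t + (Fintype.card ι - 1) * ρ := by
      intro t ht
      rw [← Finset.add_sum_erase _ _ (Finset.mem_univ i₀)] at ht
      have h1 : |∑ k ∈ Finset.univ.erase i₀, c k * y k|
          ≤ |c i₀| * ((Fintype.card ι - 1) * ρ) := by
        refine (Finset.abs_sum_le_sum_abs _ _).trans ?_
        refine (Finset.sum_le_card_nsmul _ _ (|c i₀| * ρ) fun k hk => ?_).trans_eq ?_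
        · rw [abs_mul]
          exact mul_le_mul (hi₀ k) (hz2' k (Finset.ne_of_mem_erase hk)) (abs_nonneg _) hcpos.le
        · rw [Finset.card_erase_of_mem (Finset.mem_univ _), Finset.card_univ, nsmul_eq_mul,
            Nat.cast_pred Fintype.card_pos]
          ring
      have h2 : |c i₀ * y i₀| ≤ |c i₀| * t + |c i₀| * ((Fintype.card ι - 1) * ρ) := by
        have := abs_sub (c i₀ * y i₀ + ∑ k ∈ Finset.univ.erase i₀, c k * y k)
          (∑ k ∈ Finset.univ.erase i₀, c k * y k)
        rw [add_sub_cancel_right] at this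
        linarith
      rw [abs_mul, ← mul_add] at h2
      exact le_of_mul_le_mul_left h2 hcpos
    have hyR : ∀ i, |y i| ≤ R := by
      intro i
      by_cases hi : i = i₀
      · subst hi
        linarith [key R' hz1]
      · nlinarith [hz2' i hi]
    have hker : ∑ k, c k * y k = 0 := by
      rw [hcφ]
      exact hφ (Submodule.subset_span ⟨⟨z, rfl⟩, hyR⟩)
    obtain ⟨i, hi⟩ := hr z hz0
    by_cases hii : i = i₀
    · subst hii
      have := key 0 (by rw [hker]; simp)
      linarith
    · have := hz2' i hii
      nlinarith

/-! ### The exponents as suprema of sets of real numbers -/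

/-- The real numbers `w` of which `wExponent n ζ` is the supremum. -/
def wSet (n : ℕ) (ζ : ℝ) : Set ℝ :=
  {w : ℝ | {P : ℤ[X] | P.natDegree ≤ n ∧ 0 < |aeval ζ P| ∧
      |aeval ζ P| ≤ (polyHeight P : ℝ) ^ (-w)}.Infinite}

/-- The real numbers `lam` of which `lambdaMinExponent n j ζ` is the supremum. -/
def simulSet (n j : ℕ) (ζ : ℝ) : Set ℝ :=
  {lam : ℝ | ∃ᶠ X : ℝ in atTop, ∃ v : Fin j → Fin (n + 1) → ℤ,
      LinearIndependent ℤ v ∧ ∀ k : Fin j, IsSimulSolution n ζ lam X (v k)}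

theorem wExponent_eq (n : ℕ) (ζ : ℝ) :
    wExponent n ζ = sSup ((fun w : ℝ => (w : EReal)) '' wSet n ζ) := rfl

theorem lambdaMinExponent_eq (n j : ℕ) (ζ : ℝ) :
    lambdaMinExponent n j ζ = sSup ((fun w : ℝ => (w : EReal)) '' simulSet n j ζ) := rfl

theorem lambdaExponent_eq (n : ℕ) (ζ : ℝ) : lambdaExponent n ζ = lambdaMinExponent n 1 ζ := by
  unfold lambdaExponent lambdaMinExponent
  congr 2
  ext lam
  refine Filter.frequently_congr (Eventually.of_forall fun X => ?_)
  constructor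
  · rintro ⟨v, hv⟩
    refine ⟨fun _ => v, ?_, fun _ => hv⟩
    rw [linearIndependent_unique_iff]
    intro h
    have := hv.1
    rw [h] at this
    norm_num at this
  · rintro ⟨v, -, hv⟩
    exact ⟨v 0, hv 0⟩

theorem le_sSup_coe_of_forall_lt {S : Set ℝ} {a : ℝ} (h : ∀ x < a, x ∈ S) :
    (a : EReal) ≤ sSup ((fun w : ℝ => (w : EReal)) '' S) := by
  refine le_of_forall_lt fun c hc => ?_
  obtain ⟨x, hcx, hxa⟩ := EReal.lt_iff_exists_real_btwn.1 hc
  exact hcx.trans_le (le_sSup ⟨x, h x (EReal.coe_lt_coe_iff.1 hxa), rfl⟩)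

theorem exists_mem_of_lt_sSup_coe {S : Set ℝ} {c : EReal}
    (h : c < sSup ((fun w : ℝ => (w : EReal)) '' S)) : ∃ x ∈ S, c < (x : EReal) := by
  obtain ⟨_, ⟨x, hx, rfl⟩, hc⟩ := lt_sSup_iff.1 h
  exact ⟨x, hx, hc⟩

/-! ### Integer polynomials with small value -/

theorem natAbs_coeff_le_polyHeight (P : ℤ[X]) (i : ℕ) : (P.coeff i).natAbs ≤ polyHeight P := by
  by_cases hi : i ∈ P.support
  · exact Finset.le_sup (f := fun i => (P.coeff i).natAbs) hi
  · rw [notMem_support_iff.1 hi]; simp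

theorem abs_coeff_le_polyHeight (P : ℤ[X]) (i : ℕ) : |(P.coeff i : ℝ)| ≤ polyHeight P := by
  have := natAbs_coeff_le_polyHeight P i
  rw [← Int.cast_abs, Int.abs_eq_natAbs]
  exact_mod_cast this

theorem exists_abs_coeff_eq_polyHeight {P : ℤ[X]} (hP : P ≠ 0) :
    ∃ i, |(P.coeff i : ℝ)| = polyHeight P := by
  obtain ⟨i, -, hi⟩ := Finset.exists_mem_eq_sup P.support
    (Finset.nonempty_iff_ne_empty.2 (by simpa using hP)) fun i => (P.coeff i).natAbs
  refine ⟨i, ?_⟩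
  rw [← Int.cast_abs, Int.abs_eq_natAbs, polyHeight, hi]
  simp

theorem one_le_polyHeight {P : ℤ[X]} (hP : P ≠ 0) : (1 : ℝ) ≤ polyHeight P := by
  have h : P.leadingCoeff.natAbs ≤ polyHeight P := natAbs_coeff_le_polyHeight P _
  have h0 : 0 < P.leadingCoeff.natAbs := Int.natAbs_pos.2 (leadingCoeff_ne_zero.2 hP)
  exact_mod_cast h0.trans_le h

theorem polyHeight_le {P : ℤ[X]} (hP : P ≠ 0) {B : ℝ} (h : ∀ i, |(P.coeff i : ℝ)| ≤ B) :
    (polyHeight P : ℝ) ≤ B := by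
  obtain ⟨i, hi⟩ := exists_abs_coeff_eq_polyHeight hP
  exact hi ▸ h i

theorem finite_setOf_polyHeight_le (n B : ℕ) :
    {P : ℤ[X] | P.natDegree ≤ n ∧ polyHeight P ≤ B}.Finite := by
  have h : {a : Fin (n + 1) → ℤ | ∀ i, a i ∈ Set.Icc (-(B : ℤ)) B}.Finite :=
    Set.Finite.pi' fun _ => Set.finite_Icc _ _
  refine (h.image (Polynomial.ofFn (n + 1))).subset ?_
  rintro P ⟨hd, hB⟩
  refine ⟨fun i => P.coeff i, fun i => ?_, ?_⟩
  · have := (natAbs_coeff_le_polyHeight P i).trans hB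
    change -(B : ℤ) ≤ P.coeff i ∧ P.coeff i ≤ B
    constructor <;> omega
  · ext i
    by_cases hi : i < n + 1
    · rw [ofFn_coeff_eq_val_of_lt _ hi]
    · rw [ofFn_coeff_eq_zero_of_ge _ (by omega), coeff_eq_zero_of_natDegree_lt (by omega)]

theorem aeval_ne_zero_of_transcendental {ζ : ℝ} (hζ : Transcendental ℚ ζ) {P : ℤ[X]}
    (hP : P ≠ 0) : aeval ζ P ≠ 0 := by
  have h : Transcendental ℤ ζ := hζ.restrictScalars (algebraMap ℤ ℚ).injective_int
  exact fun h0 => h ⟨P, hP, h0⟩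

/-- The polynomials that witness `w ∈ wSet n ζ` have unbounded height. -/
theorem exists_le_polyHeight_of_mem_wSet {n : ℕ} {ζ w : ℝ} (hw : w ∈ wSet n ζ) (B : ℕ) :
    ∃ P : ℤ[X], P ≠ 0 ∧ P.natDegree ≤ n ∧ |aeval ζ P| ≤ (polyHeight P : ℝ) ^ (-w) ∧
      B ≤ polyHeight P := by
  obtain ⟨P, hP, hPB⟩ := (Set.Infinite.sdiff hw (finite_setOf_polyHeight_le n B)).nonempty
  refine ⟨P, ?_, hP.1, hP.2.2, ?_⟩
  · rintro rfl
    simpa using hP.2.1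
  · by_contra h
    exact hPB ⟨hP.1, by omega⟩

/-- Polynomials with arbitrarily small value at `ζ` and a bound of order `H(P) ^ (-w₀)` on it put
every `w < w₀` into `wSet n ζ`. -/
theorem mem_wSet_of_forall_exists {n : ℕ} {ζ : ℝ} (hζ : Transcendental ℚ ζ) {C w₀ w : ℝ}
    (hw : w < w₀) (h : ∀ δ > 0, ∃ P : ℤ[X], P ≠ 0 ∧ P.natDegree ≤ n ∧ |aeval ζ P| < δ ∧
      |aeval ζ P| ≤ C * (polyHeight P : ℝ) ^ (-w₀)) : w ∈ wSet n ζ := by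
  intro hfin
  obtain ⟨B, hB⟩ := (((tendsto_rpow_atTop (sub_pos.2 hw)).comp
    tendsto_natCast_atTop_atTop).eventually_ge_atTop C).exists_forall_of_atTop
  have hT := hfin.union (finite_setOf_polyHeight_le n B)
  have hev : ∀ᶠ δ : ℝ in nhdsWithin 0 (Set.Ioi 0), ∀ P ∈
      {P : ℤ[X] | P.natDegree ≤ n ∧ 0 < |aeval ζ P| ∧
        |aeval ζ P| ≤ (polyHeight P : ℝ) ^ (-w)} ∪
      {P : ℤ[X] | P.natDegree ≤ n ∧ polyHeight P ≤ B}, P ≠ 0 → δ < |aeval ζ P| := by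
    rw [eventually_all_finite hT]
    intro P _
    by_cases hP : P = 0
    · simp [hP]
    · filter_upwards [Ioo_mem_nhdsGT (abs_pos.2 (aeval_ne_zero_of_transcendental hζ hP))]
        with δ hδ _ using hδ.2
  obtain ⟨δ, hδ, hδ0⟩ := (hev.and self_mem_nhdsWithin).exists
  obtain ⟨P, hP0, hPn, hPδ, hPC⟩ := h δ hδ0
  have hnot := fun hmem => (hδ P hmem hP0).not_gt hPδ
  have hHB : B ≤ polyHeight P := by
    by_contra hlt
    exact hnot (Or.inr ⟨hPn, by omega⟩)
  refine hnot (Or.inl ⟨hPn, abs_pos.2 (aeval_ne_zero_of_transcendental hζ hP0), hPC.trans ?_⟩)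
  have hH : (0 : ℝ) < polyHeight P := by linarith [one_le_polyHeight hP0]
  calc C * (polyHeight P : ℝ) ^ (-w₀)
      ≤ (polyHeight P : ℝ) ^ (w₀ - w) * (polyHeight P : ℝ) ^ (-w₀) :=
        mul_le_mul_of_nonneg_right (hB _ hHB) (by positivity)
    _ = (polyHeight P : ℝ) ^ (-w) := by rw [← Real.rpow_add hH]; congr 1; ring

theorem wSet_mono {k n : ℕ} (h : k ≤ n) (ζ : ℝ) : wSet k ζ ⊆ wSet n ζ :=
  fun _ hw => Set.Infinite.mono (fun _ hP => ⟨hP.1.trans h, hP.2⟩) hw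

theorem wExponent_mono {k n : ℕ} (h : k ≤ n) (ζ : ℝ) : wExponent k ζ ≤ wExponent n ζ :=
  sSup_le_sSup (Set.image_mono (wSet_mono h ζ))

theorem ofFn_ne_zero {N : ℕ} {a : Fin N → ℤ} (ha : a ≠ 0) : Polynomial.ofFn N a ≠ 0 := by
  intro h
  apply ha
  funext i
  have := ofFn_coeff_eq_val_of_lt a i.2
  rw [h] at this
  simpa using this.symm

theorem natDegree_ofFn_le (n : ℕ) (a : Fin (n + 1) → ℤ) :
    (Polynomial.ofFn (n + 1) a).natDegree ≤ n :=
  Nat.lt_succ_iff.1 (ofFn_natDegree_lt (by omega) a)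

theorem aeval_ofFn (n : ℕ) (a : Fin (n + 1) → ℤ) (ζ : ℝ) :
    aeval ζ (Polynomial.ofFn (n + 1) a) = ∑ i : Fin (n + 1), (a i : ℝ) * ζ ^ (i : ℕ) := by
  rw [aeval_eq_sum_range' (ofFn_natDegree_lt (by omega) a), Finset.sum_range]
  refine Finset.sum_congr rfl fun i _ => ?_
  rw [ofFn_coeff_eq_val_of_lt a i.2, zsmul_eq_mul]

theorem polyHeight_ofFn_le {N : ℕ} {a : Fin N → ℤ} (ha : a ≠ 0) {B : ℝ}
    (h : ∀ i, |(a i : ℝ)| ≤ B) : (polyHeight (Polynomial.ofFn N a) : ℝ) ≤ B := by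
  obtain ⟨i₀, -⟩ := Function.ne_iff.1 ha
  have hB : 0 ≤ B := (abs_nonneg _).trans (h i₀)
  refine polyHeight_le (ofFn_ne_zero ha) fun i => ?_
  by_cases hi : i < N
  · rw [ofFn_coeff_eq_val_of_lt a hi]; exact h _
  · rw [ofFn_coeff_eq_zero_of_ge _ (by omega)]; simpa using hB

/-! ### Integer vectors close to the line spanned by the powers -/

/-- Estimates of orders `H ^ α` and `H ^ (-β)` for arbitrarily large `H` put every number
below `β / α` into `simulSet n j ζ`. -/
theorem mem_simulSet_of_frequently {n j : ℕ} {ζ C α β μ : ℝ} (hα : 0 < α) (hβ : 0 < β)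
    (hμ : μ < β / α)
    (h : ∃ᶠ H : ℝ in atTop, ∃ v : Fin j → Fin (n + 1) → ℤ, LinearIndependent ℤ v ∧
      ∀ k, |(v k 0 : ℝ)| ≤ C * H ^ α ∧ ∀ i : Fin n,
        |ζ ^ ((i : ℕ) + 1) * (v k 0 : ℝ) - (v k i.succ : ℝ)| ≤ C * H ^ (-β)) :
    μ ∈ simulSet n j ζ := by
  -- a positive exponent `ν ≥ μ` still below `β / α`, and `C` replaced by `D ≥ 1`
  obtain ⟨ν, hν1, hν2⟩ := exists_between (max_lt hμ (div_pos hβ hα))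
  have hμν : μ < ν := (le_max_left _ _).trans_lt hν1
  have hν0 : 0 < ν := (le_max_right _ _).trans_lt hν1
  set D := max C 1
  have hD : 0 < D := lt_of_lt_of_le one_pos (le_max_right _ _)
  have hγ : 0 < β - α * ν := by
    have := (lt_div_iff₀ hα).1 hν2
    linarith
  have hev : ∀ᶠ H : ℝ in atTop, 1 ≤ H ∧ D < H ^ β ∧ D * D ^ ν ≤ H ^ (β - α * ν) :=
    (eventually_ge_atTop 1).and (((tendsto_rpow_atTop hβ).eventually_gt_atTop _).and
      ((tendsto_rpow_atTop hγ).eventually_ge_atTop _))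
  have htend : Tendsto (fun H : ℝ => D * H ^ α) atTop atTop :=
    (tendsto_rpow_atTop hα).const_mul_atTop hD
  refine htend.frequently ?_
  refine (hev.and_frequently h).mono ?_
  rintro H ⟨⟨hH1, hHβ, hHγ⟩, v, hli, hv⟩
  have hH : 0 < H := by linarith
  have hX1 : 1 ≤ D * H ^ α :=
    one_le_mul_of_one_le_of_one_le (le_max_right _ _) (Real.one_le_rpow hH1 hα.le)
  refine ⟨v, hli, fun k => ⟨?_, ?_, fun i => ?_⟩⟩
  · -- if the first coordinate vanished, the others would be integers of absolute value `< 1`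
    have h0 : v k 0 ≠ 0 := by
      intro h0
      apply hli.ne_zero k
      funext i
      refine Fin.cases h0 (fun i => ?_) i
      have := (hv k).2 i
      rw [h0, Int.cast_zero, mul_zero, zero_sub, abs_neg] at this
      have h1 : C * H ^ (-β) < 1 := by
        rw [Real.rpow_neg hH.le, ← div_eq_mul_inv, div_lt_one (by positivity)]
        exact (le_max_left _ _).trans_lt hHβ
      have h2 : |(v k i.succ : ℝ)| < 1 := this.trans_lt h1
      rw [← Int.cast_abs] at h2
      exact Int.abs_lt_one_iff.1 (by exact_mod_cast h2)
    rw [← Int.cast_abs]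
    exact_mod_cast Int.one_le_abs h0
  · exact (hv k).1.trans (mul_le_mul_of_nonneg_right (le_max_left _ _) (by positivity))
  · refine ((hv k).2 i).trans ?_
    calc C * H ^ (-β) ≤ D * H ^ (-β) :=
          mul_le_mul_of_nonneg_right (le_max_left _ _) (by positivity)
      _ ≤ (D * H ^ α) ^ (-ν) := by
          rw [Real.mul_rpow hD.le (by positivity), ← Real.rpow_mul hH.le,
            Real.rpow_neg hD.le, ← div_eq_inv_mul, le_div_iff₀ (by positivity)]
          calc D * H ^ (-β) * D ^ ν = D * D ^ ν * H ^ (-β) := by ring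
            _ ≤ H ^ (β - α * ν) * H ^ (-β) := mul_le_mul_of_nonneg_right hHγ (by positivity)
            _ = H ^ (α * -ν) := by rw [← Real.rpow_add hH]; congr 1; ring
      _ ≤ (D * H ^ α) ^ (-μ) := Real.rpow_le_rpow_of_exponent_le hX1 (by linarith)

theorem linearIndependent_const_of_ne_zero {N : ℕ} {z : Fin N → ℤ} (hz : z ≠ 0) :
    LinearIndependent ℤ fun _ : Fin 1 => z :=
  linearIndependent_unique_iff.2 hz

theorem lambdaMinExponent_le_lambdaExponent (n : ℕ) {j : ℕ} (hj : 1 ≤ j) (ζ : ℝ) :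
    lambdaMinExponent n j ζ ≤ lambdaExponent n ζ := by
  refine sSup_le_sSup (Set.image_mono ?_)
  intro lam hlam
  refine Frequently.mono hlam ?_
  rintro X ⟨v, -, hv⟩
  exact ⟨v ⟨0, hj⟩, hv _⟩

theorem lambdaExponent_anti {k n : ℕ} (h : k ≤ n) (ζ : ℝ) :
    lambdaExponent n ζ ≤ lambdaExponent k ζ := by
  refine sSup_le_sSup (Set.image_mono ?_)
  intro lam hlam
  refine Frequently.mono hlam ?_
  rintro X ⟨v, h1, h2, h3⟩
  exact ⟨fun i => v (Fin.castLE (by omega) i), by simpa using h1, by simpa using h2,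
    fun i => h3 (Fin.castLE h i)⟩

/-- The matrix of the linear forms `z ↦ z 0` and `z ↦ z i - ζ ^ i * z 0` for `1 ≤ i ≤ n`. -/
def powMatrix (n : ℕ) (ζ : ℝ) : Matrix (Fin (n + 1)) (Fin (n + 1)) ℝ :=
  (1 : Matrix (Fin (n + 1)) (Fin (n + 1)) ℝ).updateCol 0
    fun i => if i = 0 then 1 else -ζ ^ (i : ℕ)

theorem det_powMatrix (n : ℕ) (ζ : ℝ) : (powMatrix n ζ).det = 1 := by
  rw [powMatrix, ← Matrix.cramer_apply, Matrix.cramer_one]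
  simp

theorem powMatrix_mulVec_zero (n : ℕ) (ζ : ℝ) (z : Fin (n + 1) → ℝ) :
    (powMatrix n ζ).mulVec z 0 = z 0 := by
  simp [powMatrix, Matrix.mulVec, dotProduct, Fin.sum_univ_succ, Matrix.updateCol_apply,
    Matrix.one_apply, Fin.succ_ne_zero, (Fin.succ_ne_zero _).symm]

theorem powMatrix_mulVec_succ (n : ℕ) (ζ : ℝ) (z : Fin (n + 1) → ℝ) (i : Fin n) :
    (powMatrix n ζ).mulVec z i.succ = z i.succ - ζ ^ ((i : ℕ) + 1) * z 0 := by
  simp [powMatrix, Matrix.mulVec, dotProduct, Fin.sum_univ_succ, Matrix.updateCol_apply,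
    Matrix.one_apply, Fin.succ_ne_zero]
  ring

theorem abs_powMatrix_mulVec_succ (n : ℕ) (ζ : ℝ) (z : Fin (n + 1) → ℝ) (i : Fin n) :
    |(powMatrix n ζ).mulVec z i.succ| = |ζ ^ ((i : ℕ) + 1) * z 0 - z i.succ| := by
  rw [powMatrix_mulVec_succ, abs_sub_comm]

/-! ### Dirichlet's theorem -/

theorem prod_cons_const (n : ℕ) (a b : ℝ) :
    ∏ i : Fin (n + 1), (Fin.cons a (fun _ => b) : Fin (n + 1) → ℝ) i = a * b ^ n := by
  simp [Fin.prod_univ_succ]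

/-- Dirichlet's theorem for the powers of `ζ`, at every `X ≥ 1`. -/
theorem exists_dirichlet_simultaneous {n : ℕ} (hn : 1 ≤ n) (ζ : ℝ) {X : ℝ} (hX : 1 ≤ X) :
    ∃ z : Fin (n + 1) → ℤ, z ≠ 0 ∧ |(z 0 : ℝ)| ≤ 2 * X ∧ ∀ i : Fin n,
      |ζ ^ ((i : ℕ) + 1) * (z 0 : ℝ) - (z i.succ : ℝ)| ≤ X ^ (-(1 / (n : ℝ))) := by
  have hX0 : 0 < X := by linarith
  have hn0 : (n : ℝ) ≠ 0 := by positivity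
  obtain ⟨z, hz, hb⟩ := exists_int_abs_mulVec_le (powMatrix n ζ) (by simp [det_powMatrix])
    (Fin.cons (2 * X) fun _ => X ^ (-(1 / (n : ℝ))))
    (fun i => Fin.cases (by simpa using hX0) (fun i => by simp only [Fin.cons_succ]; positivity) i)
    (by
      rw [prod_cons_const, det_powMatrix, ← Real.rpow_natCast, ← Real.rpow_mul hX0.le,
        neg_mul, one_div, inv_mul_cancel₀ hn0, Real.rpow_neg_one, mul_assoc,
        mul_inv_cancel₀ hX0.ne']
      norm_num)
  refine ⟨z, hz, ?_, fun i => ?_⟩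
  · simpa [powMatrix_mulVec_zero] using hb 0
  · simpa [abs_powMatrix_mulVec_succ] using hb i.succ

theorem one_div_le_lambdaExponent {n : ℕ} (hn : 1 ≤ n) (ζ : ℝ) :
    ((1 / (n : ℝ) : ℝ) : EReal) ≤ lambdaExponent n ζ := by
  rw [lambdaExponent_eq]
  refine le_sSup_coe_of_forall_lt fun μ hμ => ?_
  refine mem_simulSet_of_frequently (C := 2) (α := 1) (β := 1 / (n : ℝ)) one_pos (by positivity)
    (by simpa using hμ) (Eventually.frequently ?_)
  filter_upwards [eventually_ge_atTop 1] with X hX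
  obtain ⟨z, hz, h0, hi⟩ := exists_dirichlet_simultaneous hn ζ hX
  refine ⟨fun _ => z, linearIndependent_const_of_ne_zero hz, fun _ => ⟨by simpa using h0,
    fun i => (hi i).trans ?_⟩⟩
  linarith [Real.rpow_nonneg (zero_le_one.trans hX) (-(1 / (n : ℝ)))]

/-- A linear form `a 0 + a 1 * ζ + ... + a n * ζ ^ n` bounds its constant coefficient. -/
theorem abs_zero_le_of_abs_sum_le {n : ℕ} {ζ A ε : ℝ} {a : Fin (n + 1) → ℤ}
    (ha : ∀ i : Fin n, |(a i.succ : ℝ)| ≤ A)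
    (h : |∑ i : Fin (n + 1), (a i : ℝ) * ζ ^ (i : ℕ)| ≤ ε) :
    |(a 0 : ℝ)| ≤ ε + A * ∑ i : Fin n, |ζ| ^ ((i : ℕ) + 1) := by
  rw [Fin.sum_univ_succ] at h
  simp only [Fin.val_zero, pow_zero, mul_one, Fin.val_succ] at h
  have h1 : |∑ i : Fin n, (a i.succ : ℝ) * ζ ^ ((i : ℕ) + 1)|
      ≤ A * ∑ i : Fin n, |ζ| ^ ((i : ℕ) + 1) := by
    rw [Finset.mul_sum]
    refine (Finset.abs_sum_le_sum_abs _ _).trans (Finset.sum_le_sum fun i _ => ?_)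
    rw [abs_mul, abs_pow]
    exact mul_le_mul_of_nonneg_right (ha i) (by positivity)
  have h2 := abs_sub ((a 0 : ℝ) + ∑ i : Fin n, (a i.succ : ℝ) * ζ ^ ((i : ℕ) + 1))
    (∑ i : Fin n, (a i.succ : ℝ) * ζ ^ ((i : ℕ) + 1))
  rw [add_sub_cancel_right] at h2
  linarith

theorem le_wExponent {n : ℕ} (hn : 1 ≤ n) {ζ : ℝ} (hζ : Transcendental ℚ ζ) :
    ((n : ℝ) : EReal) ≤ wExponent n ζ := by
  rw [wExponent_eq]
  refine le_sSup_coe_of_forall_lt fun w hw => ?_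
  set K : ℝ := 2 + ∑ i : Fin n, |ζ| ^ ((i : ℕ) + 1) with hK
  have hS : 0 ≤ ∑ i : Fin n, |ζ| ^ ((i : ℕ) + 1) := Finset.sum_nonneg fun i _ => by positivity
  have hK0 : 0 < K := by positivity
  have hn0 : (0 : ℝ) < n := by positivity
  refine mem_wSet_of_forall_exists hζ (C := 2 * K ^ (n : ℝ)) hw fun δ hδ => ?_
  obtain ⟨Q, hQ1, hQδ⟩ := ((eventually_ge_atTop (1 : ℝ)).and
    ((tendsto_rpow_atTop hn0).eventually_gt_atTop (2 / δ))).exists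
  have hQ : 0 < Q := by linarith
  obtain ⟨a, ha, ha0, hai⟩ := exists_int_abs_sum_le
    (1 : Matrix (Fin (n + 1)) (Fin (n + 1)) ℝ) (by simp) (fun i => ζ ^ (i : ℕ)) 0 (by simp)
    (Fin.cons (2 * Q ^ (-(n : ℝ))) fun _ => Q)
    (fun i => Fin.cases (by simp only [Fin.cons_zero]; positivity)
      (fun i => by simpa using hQ) i)
    (by
      rw [prod_cons_const, ← Real.rpow_natCast Q, mul_assoc, ← Real.rpow_add hQ]
      simp)
  have hval : |∑ i : Fin (n + 1), (a i : ℝ) * ζ ^ (i : ℕ)| ≤ 2 * Q ^ (-(n : ℝ)) := by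
    simpa [mul_comm] using ha0
  have hai' : ∀ i : Fin n, |(a i.succ : ℝ)| ≤ Q := fun i => by
    simpa using hai i.succ (Fin.succ_ne_zero i)
  have hQn : Q ^ (-(n : ℝ)) ≤ 1 := Real.rpow_le_one_of_one_le_of_nonpos hQ1 (by linarith)
  have h0 := abs_zero_le_of_abs_sum_le hai' hval
  have hH : (polyHeight (Polynomial.ofFn (n + 1) a) : ℝ) ≤ K * Q := by
    refine polyHeight_ofFn_le ha fun i => ?_
    refine Fin.cases ?_ (fun i => ?_) i
    · rw [hK]; nlinarith
    · refine (hai' i).trans ?_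
      rw [hK]; nlinarith
  refine ⟨Polynomial.ofFn (n + 1) a, ofFn_ne_zero ha, natDegree_ofFn_le n a, ?_, ?_⟩
  · rw [aeval_ofFn]
    refine hval.trans_lt ?_
    rw [Real.rpow_neg hQ.le, ← div_eq_mul_inv, div_lt_comm₀ (by positivity) hδ]
    exact hQδ
  · rw [aeval_ofFn]
    refine hval.trans ?_
    have hHpos : (0 : ℝ) < polyHeight (Polynomial.ofFn (n + 1) a) := by
      linarith [one_le_polyHeight (ofFn_ne_zero ha)]
    rw [Real.rpow_neg hQ.le, Real.rpow_neg hHpos.le, ← div_eq_mul_inv, ← div_eq_mul_inv,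
      div_le_div_iff₀ (by positivity) (by positivity), mul_assoc, ← Real.mul_rpow hK0.le hQ.le]
    exact mul_le_mul_of_nonneg_left (Real.rpow_le_rpow hHpos.le hH hn0.le) (by norm_num)

/-! ### Khintchine's transference principle -/

theorem eq_zero_of_abs_intCast_le_half {k : ℤ} (h : |(k : ℝ)| ≤ 1 / 2) : k = 0 := by
  have h2 : |(k : ℝ)| < 1 := by linarith
  rw [← Int.cast_abs] at h2
  exact Int.abs_lt_one_iff.1 (by exact_mod_cast h2)

/-- From simultaneous approximation to small polynomial values: an integer polynomial orthogonal
to a good simultaneous approximation `(x, y₁, …, yₙ)` has a small value at `ζ`. -/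
theorem mem_wSet_of_mem_simulSet {n : ℕ} (hn : 1 ≤ n) {ζ : ℝ} (hζ : Transcendental ℚ ζ)
    {lam w : ℝ} (hlam : lam ∈ simulSet n 1 ζ) (hpos : 0 < lam) (hw : w < n + n * lam - 1) :
    w ∈ wSet n ζ := by
  have hn0 : (0 : ℝ) < n := by positivity
  have hn1 : (1 : ℝ) ≤ n := by exact_mod_cast hn
  set S := ∑ i : Fin n, |ζ| ^ ((i : ℕ) + 1)
  have hS : 0 ≤ S := Finset.sum_nonneg fun i _ => by positivity
  set K : ℝ := 1 + 3 * n + S with hK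
  have hK0 : 0 < K := by positivity
  set w₀ : ℝ := n + n * lam - 1 with hw₀
  have hw₀pos : 0 < w₀ := by nlinarith [mul_pos hn0 hpos]
  refine mem_wSet_of_forall_exists hζ (C := 3 * n * (3 * K) ^ w₀) hw fun δ hδ => ?_
  obtain ⟨X, ⟨hX1, hXδ⟩, v, -, hv⟩ := ((((eventually_ge_atTop (1 : ℝ)).and
    ((tendsto_rpow_atTop hpos).eventually_gt_atTop (3 * n / δ))).and_frequently hlam)).exists
  obtain ⟨hx1, hxX, he⟩ := hv 0
  set z := v 0
  set x : ℝ := |(z 0 : ℝ)| with hx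
  have hx0 : 0 < x := by linarith
  have hX0 : 0 < X := by linarith
  set q : ℝ := x ^ (1 / (n : ℝ)) with hq
  have hq0 : 0 < q := Real.rpow_pos_of_pos hx0 _
  have hqn : q ^ n = x := by
    rw [hq, ← Real.rpow_natCast, ← Real.rpow_mul hx0.le, one_div, inv_mul_cancel₀ hn0.ne',
      Real.rpow_one]
  have hq1 : 1 ≤ q := Real.one_le_rpow hx1 (by positivity)
  have hqx : q ≤ x := by
    rw [← hqn]; exact le_self_pow₀ hq1 (by omega)
  -- the coefficients `a 1, ..., a n` are bounded by `3 q`, where `q ^ n = |z 0|`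
  obtain ⟨a, ha, ha0, hai⟩ := exists_int_abs_sum_le
    (1 : Matrix (Fin (n + 1)) (Fin (n + 1)) ℝ) (by simp) (fun i => (z i : ℝ)) 0
    (by rw [← abs_pos]; exact hx0)
    (Fin.cons (1 / 2) fun _ => 3 * q)
    (fun i => Fin.cases (by simp) (fun i => by simpa using hq0) i)
    (by
      rw [prod_cons_const, mul_pow, hqn]
      have : (3 : ℝ) ≤ 3 ^ n := le_self_pow₀ (by norm_num) (by omega)
      simp only [Matrix.det_one, abs_one, mul_one]
      nlinarith)
  have hai' : ∀ i : Fin n, |(a i.succ : ℝ)| ≤ 3 * q := fun i => by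
    simpa using hai i.succ (Fin.succ_ne_zero i)
  have horth : ∑ i : Fin (n + 1), (z i : ℝ) * a i = 0 := by
    have h1 : ∑ i : Fin (n + 1), z i * a i = 0 := by
      apply eq_zero_of_abs_intCast_le_half
      simpa using ha0
    exact_mod_cast h1
  set V := ∑ i : Fin (n + 1), (a i : ℝ) * ζ ^ (i : ℕ) with hV
  have hVz : V * z 0 = ∑ i : Fin n,
      (a i.succ : ℝ) * (ζ ^ ((i : ℕ) + 1) * (z 0 : ℝ) - (z i.succ : ℝ)) := by
    have h1 : V * z 0 = V * z 0 - ∑ i : Fin (n + 1), (z i : ℝ) * a i := by rw [horth, sub_zero]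
    rw [h1, hV, Fin.sum_univ_succ, Fin.sum_univ_succ, add_mul, Finset.sum_mul]
    simp only [Fin.val_zero, pow_zero, mul_one, Fin.val_succ, mul_sub, Finset.sum_sub_distrib]
    have h2 : ∑ i : Fin n, (a i.succ : ℝ) * ζ ^ ((i : ℕ) + 1) * z 0
        = ∑ i : Fin n, (a i.succ : ℝ) * (ζ ^ ((i : ℕ) + 1) * z 0) :=
      Finset.sum_congr rfl fun i _ => by ring
    have h3 : ∑ i : Fin n, (z i.succ : ℝ) * a i.succ
        = ∑ i : Fin n, (a i.succ : ℝ) * z i.succ := Finset.sum_congr rfl fun i _ => by ring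
    rw [h2, h3]; ring
  have hVx : |V| * x ≤ n * (3 * q * X ^ (-lam)) := by
    rw [hx, ← abs_mul, hVz]
    refine (Finset.abs_sum_le_sum_abs _ _).trans ?_
    refine (Finset.sum_le_card_nsmul _ _ (3 * q * X ^ (-lam)) fun i _ => ?_).trans_eq (by simp)
    rw [abs_mul]
    exact mul_le_mul (hai' i) (he i) (abs_nonneg _) (by positivity)
  have hV1 : |V| ≤ 3 * n * X ^ (-lam) := by
    have h1 : |V| * x ≤ 3 * n * X ^ (-lam) * x := by
      refine hVx.trans ?_
      have : 0 ≤ 3 * n * X ^ (-lam) := by positivity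
      nlinarith [mul_le_mul_of_nonneg_left hqx this]
    exact le_of_mul_le_mul_right h1 hx0
  have hXl : X ^ (-lam) ≤ 1 := Real.rpow_le_one_of_one_le_of_nonpos hX1 (by linarith)
  have hV2 : |V| ≤ 3 * n * q ^ (-w₀) := by
    have h1 : X ^ (-lam) ≤ x ^ (-lam) := Real.rpow_le_rpow_of_nonpos hx0 hxX (by linarith)
    have h2 : |V| * x ≤ 3 * n * q ^ (-w₀) * x := by
      refine hVx.trans ?_
      have h3 : q ^ (-w₀) * x = q * x ^ (-lam) := by
        rw [← hqn, ← Real.rpow_natCast, ← Real.rpow_add hq0, ← Real.rpow_mul hq0.le]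
        nth_rewrite 2 [← Real.rpow_one q]
        rw [← Real.rpow_add hq0]
        congr 1
        rw [hw₀]; ring
      have h4 : 3 * n * (q * X ^ (-lam)) ≤ 3 * n * (q * x ^ (-lam)) := by gcongr
      calc n * (3 * q * X ^ (-lam)) = 3 * n * (q * X ^ (-lam)) := by ring
        _ ≤ 3 * n * (q * x ^ (-lam)) := h4
        _ = 3 * n * q ^ (-w₀) * x := by rw [← h3]; ring
    exact le_of_mul_le_mul_right h2 hx0
  have h0 := abs_zero_le_of_abs_sum_le hai' hV1
  have hH : (polyHeight (Polynomial.ofFn (n + 1) a) : ℝ) ≤ 3 * K * q := by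
    refine polyHeight_ofFn_le ha fun i => ?_
    refine Fin.cases ?_ (fun i => ?_) i
    · rw [hK]
      have : 3 * n * X ^ (-lam) ≤ 3 * n * 1 := by gcongr
      nlinarith [mul_le_mul_of_nonneg_left hq1 hn0.le]
    · refine (hai' i).trans ?_
      rw [hK]; nlinarith [mul_nonneg hS hq0.le, mul_pos hn0 hq0]
  refine ⟨Polynomial.ofFn (n + 1) a, ofFn_ne_zero ha, natDegree_ofFn_le n a, ?_, ?_⟩
  · rw [aeval_ofFn]
    refine hV1.trans_lt ?_
    rw [Real.rpow_neg hX0.le, ← div_eq_mul_inv, div_lt_comm₀ (by positivity) hδ]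
    exact hXδ
  · rw [aeval_ofFn]
    refine hV2.trans ?_
    have hHpos : (0 : ℝ) < polyHeight (Polynomial.ofFn (n + 1) a) := by
      linarith [one_le_polyHeight (ofFn_ne_zero ha)]
    rw [Real.rpow_neg hq0.le, Real.rpow_neg hHpos.le, ← div_eq_mul_inv, ← div_eq_mul_inv,
      div_le_div_iff₀ (by positivity) (by positivity), mul_assoc (3 * (n : ℝ)),
      ← Real.mul_rpow (by positivity) hq0.le]
    exact mul_le_mul_of_nonneg_left (Real.rpow_le_rpow hHpos.le hH hw₀pos.le) (by positivity)

/-- From small polynomial values to simultaneous approximation: an integer vector orthogonal to the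
coefficients of a polynomial with small value at `ζ` can be chosen so that `n - 1` of its
coordinates are good approximations, and then the relation makes the last one good as well. -/
theorem mem_simulSet_of_mem_wSet {n : ℕ} (hn : 1 ≤ n) {ζ w μ : ℝ} (hw : w ∈ wSet n ζ)
    (hw0 : 0 < w) (hμ : μ < w / ((n - 1) * w + n)) : μ ∈ simulSet n 1 ζ := by
  have hn0 : (0 : ℝ) < n := by positivity
  have hn1 : (1 : ℝ) ≤ n := by exact_mod_cast hn
  -- these exponents solve `α - (n - 1) * β = 1` and `α - w = 1 - β`
  set α : ℝ := w + 1 - w / n with hα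
  set β : ℝ := w / n with hβ
  have hβ0 : 0 < β := by positivity
  have hβw : β ≤ w := div_le_self hw0.le hn1
  have hα0 : 0 < α := by rw [hα]; linarith
  have hβα : β / α = w / ((n - 1) * w + n) := by
    have : (n - 1) * w + n = n * α := by rw [hα, hβ]; field_simp; ring
    rw [this, hβ, div_div]
  set S := ∑ i : Fin n, |ζ| ^ ((i : ℕ) + 1)
  have hS : 0 ≤ S := Finset.sum_nonneg fun i _ => by positivity
  refine mem_simulSet_of_frequently (C := 3 * (1 + S) + n) hα0 hβ0 (by rwa [hβα]) ?_
  rw [frequently_atTop]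
  intro B
  obtain ⟨P, hP0, hPn, hPw, hPB⟩ := exists_le_polyHeight_of_mem_wSet hw (max 2 ⌈B⌉₊)
  set H : ℝ := ((polyHeight P : ℕ) : ℝ) with hH
  have hH2 : 2 ≤ H := by rw [hH]; exact_mod_cast (le_max_left _ _).trans hPB
  have hHB : B ≤ H := (Nat.le_ceil B).trans
    (by rw [hH]; exact_mod_cast (le_max_right _ _).trans hPB)
  have hHpos : 0 < H := by linarith
  refine ⟨H, hHB, ?_⟩
  have hVsum : aeval ζ P = ∑ i : Fin (n + 1), (P.coeff i : ℝ) * ζ ^ (i : ℕ) := by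
    rw [aeval_eq_sum_range' (Nat.lt_succ_of_le hPn), Finset.sum_range]
    exact Finset.sum_congr rfl fun i _ => zsmul_eq_mul _ _
  set V := aeval ζ P with hV
  have hVlt1 : |V| < 1 := hPw.trans_lt (Real.rpow_lt_one_of_one_lt_of_neg (by linarith)
    (by linarith))
  have : Nonempty (Fin n) := ⟨⟨0, hn⟩⟩
  obtain ⟨i₀, hi₀⟩ := Finite.exists_max fun i : Fin n => |(P.coeff (i + 1) : ℝ)|
  set h₁ : ℝ := |(P.coeff (i₀ + 1) : ℝ)| with hh₁
  have h₁H : h₁ ≤ H := abs_coeff_le_polyHeight P _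
  have hcoeff0 : |(P.coeff 0 : ℝ)| ≤ |V| + h₁ * S := by
    refine abs_zero_le_of_abs_sum_le (a := fun i : Fin (n + 1) => P.coeff i) hi₀ ?_
    rw [← hVsum]
  -- the maximal coefficient other than the constant one is comparable to the height
  have h₁pos : 0 < h₁ ∧ H ≤ (1 + S) * h₁ := by
    have h₁nn : 0 ≤ h₁ := abs_nonneg _
    have hHle : H ≤ max h₁ (1 + h₁ * S) := by
      refine polyHeight_le hP0 fun i => ?_
      rcases Nat.eq_zero_or_pos i with rfl | hi
      · exact le_max_of_le_right (by linarith)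
      · by_cases hin : i ≤ n
        · have := hi₀ ⟨i - 1, by omega⟩
          simp only [Nat.sub_add_cancel hi] at this
          exact le_max_of_le_left this
        · rw [coeff_eq_zero_of_natDegree_lt (by omega)]
          simpa using Or.inl h₁nn
    have hne : P.coeff (i₀ + 1) ≠ 0 := by
      intro h0
      have h₁z : h₁ = 0 := by rw [hh₁, h0, Int.cast_zero, abs_zero]
      rw [h₁z, zero_mul, add_zero, max_eq_right zero_le_one] at hHle
      linarith
    have h₁1 : 1 ≤ h₁ := by
      rw [hh₁, ← Int.cast_abs]
      exact_mod_cast Int.one_le_abs hne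
    refine ⟨by linarith, hHle.trans (max_le ?_ ?_)⟩ <;> nlinarith [mul_nonneg h₁nn hS]
  obtain ⟨h₁0, hHh₁⟩ := h₁pos
  set X : ℝ := H ^ α with hX
  set Y : ℝ := H ^ (-β) with hY
  have hX0 : 0 < X := Real.rpow_pos_of_pos hHpos _
  have hY0 : 0 < Y := Real.rpow_pos_of_pos hHpos _
  have hXY : X * Y ^ (n - 1) = H := by
    rw [hX, hY, ← Real.rpow_natCast, ← Real.rpow_mul hHpos.le, ← Real.rpow_add hHpos,
      Nat.cast_pred hn]
    have : α + -β * ((n : ℝ) - 1) = 1 := by rw [hα, hβ]; field_simp; ring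
    rw [this, Real.rpow_one]
  have hXV : X * |V| ≤ H * Y := by
    calc X * |V| ≤ X * H ^ (-w) := mul_le_mul_of_nonneg_left hPw hX0.le
      _ = H * Y := by
        rw [hX, hY, ← Real.rpow_add hHpos]
        nth_rewrite 2 [← Real.rpow_one H]
        rw [← Real.rpow_add hHpos]
        congr 1
        rw [hα, hβ]; ring
  -- the combination below is the integral form `∑ P.coeff i * z i`; it replaces the form with
  -- index `i₀ + 1`, where its coefficient is largest
  obtain ⟨z, hz, hz1, hz2⟩ := exists_int_abs_sum_le (powMatrix n ζ) (by simp [det_powMatrix])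
    (Fin.cons V fun i : Fin n => (P.coeff (i + 1) : ℝ)) i₀.succ
    (by simpa using abs_pos.1 h₁0)
    (Fin.cons (3 * X) (Function.update (fun _ => Y) i₀ (1 / 2)))
    (fun i => Fin.cases (by simpa using hX0) (fun i => by
      simp only [Fin.cons_succ, Function.update_apply]
      split_ifs <;> positivity) i)
    (by
      rw [Fin.prod_univ_succ]
      simp only [Fin.cons_zero, Fin.cons_succ, det_powMatrix, abs_one, mul_one]
      rw [Finset.prod_update_of_mem (Finset.mem_univ _), Finset.prod_const,
        Finset.card_sdiff_of_subset (by simp), Finset.card_univ, Finset.card_singleton,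
        Fintype.card_fin]
      rw [show 3 * X * (1 / 2 * Y ^ (n - 1)) = 3 / 2 * (X * Y ^ (n - 1)) by ring, hXY]
      exact lt_of_le_of_lt h₁H (by linarith))
  have hz0 : |(z 0 : ℝ)| ≤ 3 * X := by
    simpa [powMatrix_mulVec_zero] using hz2 0 (Fin.succ_ne_zero _).symm
  have he : ∀ i, i ≠ i₀ → |(z i.succ : ℝ) - ζ ^ ((i : ℕ) + 1) * z 0| ≤ Y := fun i hi => by
    have := hz2 i.succ (by simpa using hi)
    simpa [powMatrix_mulVec_succ, Function.update_of_ne hi] using this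
  have hrel : V * z 0 + ∑ i : Fin n,
      (P.coeff (i + 1) : ℝ) * ((z i.succ : ℝ) - ζ ^ ((i : ℕ) + 1) * z 0) = 0 := by
    have hint : V * z 0 + ∑ i : Fin n,
        (P.coeff (i + 1) : ℝ) * ((z i.succ : ℝ) - ζ ^ ((i : ℕ) + 1) * z 0)
        = ((∑ i : Fin (n + 1), P.coeff i * z i : ℤ) : ℝ) := by
      rw [hVsum, Fin.sum_univ_succ, Fin.sum_univ_succ]
      push_cast
      simp only [Fin.val_zero, pow_zero, mul_one, Fin.val_succ, mul_sub, Finset.sum_sub_distrib]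
      rw [add_mul, Finset.sum_mul]
      have h2 : ∑ i : Fin n, (P.coeff (i + 1) : ℝ) * ζ ^ ((i : ℕ) + 1) * z 0
          = ∑ i : Fin n, (P.coeff (i + 1) : ℝ) * (ζ ^ ((i : ℕ) + 1) * z 0) :=
        Finset.sum_congr rfl fun i _ => by ring
      rw [h2]; ring
    rw [Fin.sum_univ_succ] at hz1
    simp only [Fin.cons_zero, Fin.cons_succ, powMatrix_mulVec_zero, powMatrix_mulVec_succ,
      Function.update_self] at hz1
    rw [hint] at hz1 ⊢
    rw [eq_zero_of_abs_intCast_le_half hz1, Int.cast_zero]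
  have hlast : |(z i₀.succ : ℝ) - ζ ^ ((i₀ : ℕ) + 1) * z 0| ≤ (3 * (1 + S) + n) * Y := by
    rw [← Finset.add_sum_erase _ _ (Finset.mem_univ i₀)] at hrel
    set E := ∑ i ∈ Finset.univ.erase i₀,
      (P.coeff (i + 1) : ℝ) * ((z i.succ : ℝ) - ζ ^ ((i : ℕ) + 1) * z 0) with hE
    have hEle : |E| ≤ n * (h₁ * Y) := by
      refine (Finset.abs_sum_le_sum_abs _ _).trans ?_
      refine (Finset.sum_le_card_nsmul _ _ (h₁ * Y) fun k hk => ?_).trans ?_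
      · rw [abs_mul]
        exact mul_le_mul (hi₀ k) (he k (Finset.ne_of_mem_erase hk)) (abs_nonneg _) h₁0.le
      · rw [nsmul_eq_mul]
        refine mul_le_mul_of_nonneg_right ?_ (by positivity)
        exact_mod_cast (Finset.card_erase_le).trans (by simp)
    have hVz : |V * z 0| ≤ 3 * ((1 + S) * h₁ * Y) := by
      rw [abs_mul]
      calc |V| * |(z 0 : ℝ)| ≤ |V| * (3 * X) := mul_le_mul_of_nonneg_left hz0 (abs_nonneg _)
        _ = 3 * (X * |V|) := by ring
        _ ≤ 3 * (H * Y) := by linarith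
        _ ≤ 3 * ((1 + S) * h₁ * Y) := by gcongr
    have hmul : |(P.coeff (i₀ + 1) : ℝ) * ((z i₀.succ : ℝ) - ζ ^ ((i₀ : ℕ) + 1) * z 0)|
        ≤ |V * z 0| + |E| := by
      rw [show (P.coeff (i₀ + 1) : ℝ) * ((z i₀.succ : ℝ) - ζ ^ ((i₀ : ℕ) + 1) * z 0)
        = -(V * z 0) - E by linarith]
      exact (abs_sub _ _).trans_eq (by rw [abs_neg])
    rw [abs_mul] at hmul
    refine le_of_mul_le_mul_left (hmul.trans ?_) h₁0
    calc |V * z 0| + |E| ≤ 3 * ((1 + S) * h₁ * Y) + n * (h₁ * Y) := add_le_add hVz hEle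
      _ = h₁ * ((3 * (1 + S) + n) * Y) := by ring
  have hC : 3 ≤ 3 * (1 + S) + n := by linarith
  refine ⟨fun _ => z, linearIndependent_const_of_ne_zero hz, fun _ => ⟨?_, fun i => ?_⟩⟩
  · exact hz0.trans (mul_le_mul_of_nonneg_right hC hX0.le)
  · rw [abs_sub_comm]
    by_cases hi : i = i₀
    · subst hi; exact hlast
    · refine (he i hi).trans ?_
      nlinarith

/-- The transference principle at the critical exponents, one half. -/
theorem lambdaExponent_le_one_div {n : ℕ} (hn : 1 ≤ n) {ζ : ℝ} (hζ : Transcendental ℚ ζ)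
    (h : wExponent n ζ ≤ ((n : ℝ) : EReal)) :
    lambdaExponent n ζ ≤ ((1 / (n : ℝ) : ℝ) : EReal) := by
  by_contra hlt
  rw [not_le, lambdaExponent_eq, lambdaMinExponent_eq] at hlt
  obtain ⟨lam, hlam, hlt⟩ := exists_mem_of_lt_sSup_coe hlt
  have hlt : 1 / (n : ℝ) < lam := EReal.coe_lt_coe_iff.1 hlt
  have hn0 : (0 : ℝ) < n := by positivity
  rw [div_lt_iff₀ hn0] at hlt
  have hpos : 0 < lam := by
    by_contra hneg
    nlinarith
  obtain ⟨w, hw1, hw2⟩ := exists_between (show (n : ℝ) < n + n * lam - 1 by linarith)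
  have hw := mem_wSet_of_mem_simulSet hn hζ hlam hpos hw2
  have : ((w : ℝ) : EReal) ≤ (n : ℝ) := (le_sSup (Set.mem_image_of_mem _ hw)).trans h
  exact absurd (EReal.coe_le_coe_iff.1 this) (not_le.2 hw1)

/-- The transference principle at the critical exponents, the other half. -/
theorem wExponent_le {n : ℕ} (hn : 1 ≤ n) {ζ : ℝ}
    (h : lambdaExponent n ζ ≤ ((1 / (n : ℝ) : ℝ) : EReal)) :
    wExponent n ζ ≤ ((n : ℝ) : EReal) := by
  by_contra hlt
  rw [not_le, wExponent_eq] at hlt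
  obtain ⟨w, hw, hlt⟩ := exists_mem_of_lt_sSup_coe hlt
  have hlt : (n : ℝ) < w := EReal.coe_lt_coe_iff.1 hlt
  have hn1 : (1 : ℝ) ≤ n := by exact_mod_cast hn
  have hw0 : 0 < w := by linarith
  have hgt : 1 / (n : ℝ) < w / ((n - 1) * w + n) := by
    rw [div_lt_div_iff₀ (by linarith) (by nlinarith)]
    nlinarith
  obtain ⟨μ, hμ1, hμ2⟩ := exists_between hgt
  have hμ := mem_simulSet_of_mem_wSet hn hw hw0 hμ2
  rw [lambdaExponent_eq] at h
  have : ((μ : ℝ) : EReal) ≤ ((1 / (n : ℝ) : ℝ) : EReal) :=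
    (le_sSup (Set.mem_image_of_mem _ hμ)).trans h
  exact absurd (EReal.coe_le_coe_iff.1 this) (not_le.2 hμ1)

theorem wExponent_eq_iff {n : ℕ} (hn : 1 ≤ n) {ζ : ℝ} (hζ : Transcendental ℚ ζ) :
    wExponent n ζ = ((n : ℝ) : EReal) ↔ lambdaExponent n ζ = ((1 / (n : ℝ) : ℝ) : EReal) :=
  ⟨fun h => (lambdaExponent_le_one_div hn hζ h.le).antisymm (one_div_le_lambdaExponent hn ζ),
    fun h => (wExponent_le hn h.le).antisymm (le_wExponent hn hζ)⟩

theorem lambdaExponent_one {ζ : ℝ} (hζ : Transcendental ℚ ζ) :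
    lambdaExponent 1 ζ = wExponent 1 ζ := by
  have hw1 : ((1 : ℝ) : EReal) ≤ wExponent 1 ζ := by simpa using le_wExponent le_rfl hζ
  have hl1 : ((1 : ℝ) : EReal) ≤ lambdaExponent 1 ζ := by
    simpa using one_div_le_lambdaExponent le_rfl ζ
  apply le_antisymm
  · refine le_of_forall_lt fun c hc => ?_
    rcases lt_or_ge c ((1 : ℝ) : EReal) with h | h
    · exact h.trans_le hw1
    rw [lambdaExponent_eq] at hc
    obtain ⟨lam, hlam, hc⟩ := exists_mem_of_lt_sSup_coe hc
    have hpos : 1 < lam := EReal.coe_lt_coe_iff.1 (h.trans_lt hc)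
    refine hc.trans_le (le_sSup_coe_of_forall_lt fun w hw => ?_)
    exact mem_wSet_of_mem_simulSet le_rfl hζ hlam (by linarith) (by simpa using hw)
  · refine le_of_forall_lt fun c hc => ?_
    rcases lt_or_ge c ((1 : ℝ) : EReal) with h | h
    · exact h.trans_le hl1
    obtain ⟨w, hw, hc⟩ := exists_mem_of_lt_sSup_coe hc
    have hpos : 1 < w := EReal.coe_lt_coe_iff.1 (h.trans_lt hc)
    rw [lambdaExponent_eq]
    refine hc.trans_le (le_sSup_coe_of_forall_lt fun μ hμ => ?_)
    exact mem_simulSet_of_mem_wSet le_rfl hw (by linarith) (by simpa using hμ)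

/-! ### Full systems of independent solutions -/

/-- If `λ_n(ζ)` has its minimal value `1 / n`, then at every scale `X` there are `n + 1` linearly
independent solutions of nearly optimal quality. -/
theorem exists_linearIndependent_of_lambdaExponent_le {n : ℕ} (hn : 1 ≤ n) {ζ : ℝ}
    (h : lambdaExponent n ζ ≤ ((1 / (n : ℝ) : ℝ) : EReal)) {δ : ℝ} (hδ0 : 0 < δ) (hδ1 : δ < 1) :
    ∃ C : ℝ, ∀ᶠ X : ℝ in atTop, ∃ v : Fin (n + 1) → Fin (n + 1) → ℤ, LinearIndependent ℤ v ∧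
      ∀ k, |(v k 0 : ℝ)| ≤ C * X ^ (1 + δ) ∧ ∀ i : Fin n,
        |ζ ^ ((i : ℕ) + 1) * (v k 0 : ℝ) - (v k i.succ : ℝ)| ≤ C * X ^ (-(1 / (n : ℝ) - δ)) := by
  have hn0 : (0 : ℝ) < n := by positivity
  have hn1 : (1 : ℝ) ≤ n := by exact_mod_cast hn
  set ε : ℝ := δ / n with hε
  have hε0 : 0 < ε := by positivity
  have hε1 : ε < 1 := (div_le_self hδ0.le hn1).trans_lt hδ1
  have hnε : n * ε = δ := mul_div_cancel₀ _ hn0.ne'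
  -- the scaled linear forms have no nonzero integer vector of norm less than `X ^ (-ε)`
  set M : ℝ → Matrix (Fin (n + 1)) (Fin (n + 1)) ℝ := fun X =>
    Matrix.diagonal (Fin.cons X⁻¹ fun _ => X ^ (1 / (n : ℝ))) * powMatrix n ζ with hM
  have hM0 : ∀ X z, (M X).mulVec z 0 = X⁻¹ * z 0 := fun X z => by
    rw [hM, ← Matrix.mulVec_mulVec, Matrix.mulVec_diagonal, powMatrix_mulVec_zero, Fin.cons_zero]
  have hMs : ∀ X z (i : Fin n), (M X).mulVec z i.succ
      = X ^ (1 / (n : ℝ)) * (z i.succ - ζ ^ ((i : ℕ) + 1) * z 0) := fun X z i => by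
    rw [hM, ← Matrix.mulVec_mulVec, Matrix.mulVec_diagonal, powMatrix_mulVec_succ, Fin.cons_succ]
  have hmin : ∀ᶠ X : ℝ in atTop, ∀ z : Fin (n + 1) → ℤ, z ≠ 0 →
      ∃ i, X ^ (-ε) ≤ |(M X).mulVec (fun k => (z k : ℝ)) i| := by
    by_contra hfreq
    have hratio : 1 / (n : ℝ) < (1 / n + ε) / (1 - ε) := by
      rw [lt_div_iff₀ (by linarith)]
      have : 0 < 1 / (n : ℝ) := by positivity
      nlinarith
    obtain ⟨μ, hμ1, hμ2⟩ := exists_between hratio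
    have hμ : μ ∈ simulSet n 1 ζ := by
      refine mem_simulSet_of_frequently (C := 1) (α := 1 - ε) (β := 1 / n + ε) (by linarith)
        (by positivity) hμ2 ?_
      rw [not_eventually] at hfreq
      refine ((eventually_gt_atTop 0).and_frequently hfreq).mono ?_
      rintro X ⟨hX, hz⟩
      push Not at hz
      obtain ⟨z, hz, hzi⟩ := hz
      refine ⟨fun _ => z, linearIndependent_const_of_ne_zero hz, fun _ => ⟨?_, fun i => ?_⟩⟩
      · have := hzi 0
        rw [hM0, abs_mul, abs_of_pos (inv_pos.2 hX), inv_mul_lt_iff₀ hX] at this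
        rw [one_mul, sub_eq_add_neg, Real.rpow_add hX, Real.rpow_one]
        exact this.le
      · have := hzi i.succ
        rw [hMs, abs_mul, abs_of_pos (Real.rpow_pos_of_pos hX _), abs_sub_comm,
          ← lt_div_iff₀' (Real.rpow_pos_of_pos hX _), ← Real.rpow_sub hX] at this
        rw [one_mul, show -(1 / (n : ℝ) + ε) = -ε - 1 / n by ring]
        exact this.le
    rw [lambdaExponent_eq] at h
    have : ((μ : ℝ) : EReal) ≤ ((1 / (n : ℝ) : ℝ) : EReal) :=
      (le_sSup (Set.mem_image_of_mem _ hμ)).trans h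
    exact absurd (EReal.coe_le_coe_iff.1 this) (not_le.2 hμ1)
  refine ⟨2 * (n + 2) ^ n + 1, ?_⟩
  filter_upwards [hmin, eventually_ge_atTop 1] with X hXmin hX1
  have hX : 0 < X := by linarith
  have hdet : (M X).det = 1 := by
    rw [hM, Matrix.det_mul, det_powMatrix, Matrix.det_diagonal, prod_cons_const,
      ← Real.rpow_natCast, ← Real.rpow_mul hX.le, one_div, inv_mul_cancel₀ hn0.ne', Real.rpow_one,
      inv_mul_cancel₀ hX.ne', one_mul]
  set r := X ^ (-ε) with hr
  have hr0 : 0 < r := Real.rpow_pos_of_pos hX _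
  have hr1 : r ≤ 1 := Real.rpow_le_one_of_one_le_of_nonpos hX1 (by linarith)
  have hrn : (r ^ n)⁻¹ = X ^ δ := by
    rw [hr, ← Real.rpow_natCast, ← Real.rpow_mul hX.le, ← Real.rpow_neg hX.le, ← hnε]
    congr 1; ring
  have hXδ : 1 ≤ X ^ δ := Real.one_le_rpow hX1 hδ0.le
  obtain ⟨v, hli, hv⟩ := exists_linearIndependent_abs_mulVec_le (M X) (by simp [hdet])
    (r := r) (ρ := r / (n + 2)) (R' := 2 * (n + 2) ^ n * X ^ δ)
    (R := (2 * (n + 2) ^ n + 1) * X ^ δ) hXmin (by positivity)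
    (by
      rw [Fintype.card_fin, mul_div_assoc', div_lt_iff₀ (by positivity)]
      push_cast
      nlinarith) (by positivity)
    (by
      rw [hdet, Fintype.card_fin, Nat.add_sub_cancel, ← hrn, div_pow, abs_one]
      have : (0 : ℝ) < (n + 2) ^ n := by positivity
      have h2 : 2 * ((n : ℝ) + 2) ^ n * (r ^ n)⁻¹ * (r ^ n / (n + 2) ^ n) = 2 := by
        field_simp
      rw [h2]; norm_num)
    (by
      rw [Fintype.card_fin, add_mul, one_mul]
      have : ((n + 1 : ℕ) : ℝ) * (r / (n + 2)) ≤ 1 := by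
        rw [mul_div_assoc', div_le_one (by positivity)]
        push_cast
        nlinarith
      linarith)
  refine ⟨v, hli, fun k => ⟨?_, fun i => ?_⟩⟩
  · have := hv k 0
    rw [hM0, abs_mul, abs_of_pos (inv_pos.2 hX), inv_mul_le_iff₀ hX] at this
    rw [Real.rpow_add hX, Real.rpow_one]
    linarith
  · have := hv k i.succ
    rw [hMs, abs_mul, abs_of_pos (Real.rpow_pos_of_pos hX _), abs_sub_comm,
      ← le_div_iff₀' (Real.rpow_pos_of_pos hX _), mul_div_assoc, ← Real.rpow_sub hX] at this
    rwa [neg_sub]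

/-! ### Solutions for higher powers from a polynomial with tiny value -/

/-- For a `U`-number of index `d + 1 ≥ 2`, the polynomials with extremely small values can be taken
of degree exactly `d + 1`. -/
theorem IsUNumber.exists_natDegree_eq {d : ℕ} (hd : 1 ≤ d) {ζ : ℝ} (hζ : IsUNumber (d + 1) ζ)
    (w : ℝ) (B : ℕ) : ∃ P : ℤ[X], P ≠ 0 ∧ P.natDegree = d + 1 ∧
      |aeval ζ P| ≤ (polyHeight P : ℝ) ^ (-w) ∧ B ≤ polyHeight P := by
  obtain ⟨b, hb, -⟩ := EReal.lt_iff_exists_real_btwn.1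
    (lt_top_iff_ne_top.2 (hζ.ne_top d hd (by omega)))
  have htop := hζ.eq_top
  rw [wExponent_eq] at htop
  obtain ⟨w₁, hw₁, hlt⟩ := exists_mem_of_lt_sSup_coe
    (htop ▸ EReal.coe_lt_top (max w b) : ((max w b : ℝ) : EReal) < _)
  have hlt : max w b < w₁ := EReal.coe_lt_coe_iff.1 hlt
  have hnot : w₁ ∉ wSet d ζ := by
    intro hmem
    have h1 : ((w₁ : ℝ) : EReal) ≤ wExponent d ζ := le_sSup (Set.mem_image_of_mem _ hmem)
    have h2 := EReal.coe_lt_coe_iff.1 (h1.trans_lt hb)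
    linarith [le_max_right w b]
  rw [wSet, Set.mem_ofPred_eq, Set.not_infinite] at hnot
  obtain ⟨P, ⟨⟨hPd, hPpos, hPw⟩, hP1⟩, hPB⟩ :=
    ((Set.Infinite.sdiff hw₁ hnot).sdiff (finite_setOf_polyHeight_le (d + 1) B)).nonempty
  have hP0 : P ≠ 0 := by
    rintro rfl
    simp at hPpos
  refine ⟨P, hP0, ?_, hPw.trans ?_, ?_⟩
  · by_contra hne
    exact hP1 ⟨by omega, hPpos, hPw⟩
  · exact Real.rpow_le_rpow_of_exponent_le (one_le_polyHeight hP0)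
      (by linarith [le_max_left w b])
  · by_contra hlt
    exact hPB ⟨hPd, by omega⟩

/-- A polynomial `P` of degree `d + 1` with tiny value at `ζ` is nearly a linear recurrence for the
powers of `ζ`. After multiplication by the leading coefficient, this recurrence extends a solution
for the powers up to `d` to one for higher powers. -/
theorem exists_extension {d n : ℕ} {P : ℤ[X]} (hP0 : P ≠ 0) (hdeg : P.natDegree = d + 1)
    {ζ Z Y : ℝ} (hZ : 1 ≤ Z) (hζZ : |ζ| ≤ Z) (y : ℕ → ℤ)
    (hY : ∀ i ≤ d, |ζ ^ i * (y 0 : ℝ) - y i| ≤ Y)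
    (hP : |aeval ζ P| * Z ^ n * ((polyHeight P : ℝ) ^ n * |(y 0 : ℝ)|) ≤ Y) (s : ℕ)
    (hs : s ≤ n) :
    ∃ y' : ℕ → ℤ, (∀ i ≤ d, y' i = P.leadingCoeff ^ s * y i) ∧
      ∀ i ≤ d + s, |ζ ^ i * (y' 0 : ℝ) - y' i| ≤ ((d + 2) * polyHeight P : ℝ) ^ s * Y := by
  set H : ℝ := ((polyHeight P : ℕ) : ℝ) with hH
  have hH1 : 1 ≤ H := one_le_polyHeight hP0
  have hY0 : 0 ≤ Y := (abs_nonneg _).trans (hY 0 (Nat.zero_le _))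
  have hlead : |(P.leadingCoeff : ℝ)| ≤ H := abs_coeff_le_polyHeight P _
  induction s with
  | zero => exact ⟨y, by simp, by simpa using hY⟩
  | succ s ih =>
    obtain ⟨y', hy', he⟩ := ih (by omega)
    set T : ℝ := ((d + 2) * H) ^ s * Y with hT
    have hT0 : 0 ≤ T := by positivity
    have hYT : Y ≤ T := le_mul_of_one_le_left hY0 (one_le_pow₀ (by nlinarith))
    have hsucc : ((d + 2) * H) ^ (s + 1) * Y = (d + 2) * (H * T) := by rw [hT]; ring
    have hTT : H * T ≤ (d + 2) * (H * T) :=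
      le_mul_of_one_le_left (by positivity) (by linarith [(Nat.cast_nonneg d : (0 : ℝ) ≤ d)])
    refine ⟨fun i => if i = d + s + 1 then -∑ l ∈ Finset.range (d + 1), P.coeff l * y' (s + l)
      else P.leadingCoeff * y' i, fun i hi => ?_, fun i hi => ?_⟩
    · simp only
      rw [if_neg (by omega), hy' i hi]; ring
    rw [hsucc]
    simp only
    rw [if_neg (by omega : ¬ 0 = d + s + 1)]
    split_ifs with his
    · have hx' : |(y' 0 : ℝ)| ≤ H ^ n * |(y 0 : ℝ)| := by
        rw [hy' 0 (Nat.zero_le _)]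
        push_cast
        rw [abs_mul, abs_pow]
        refine mul_le_mul_of_nonneg_right ?_ (abs_nonneg _)
        exact (pow_le_pow_left₀ (abs_nonneg _) hlead s).trans (pow_le_pow_right₀ hH1 (by omega))
      have hV : aeval ζ P = ∑ l ∈ Finset.range (d + 1), (P.coeff l : ℝ) * ζ ^ l
          + P.leadingCoeff * ζ ^ (d + 1) := by
        rw [aeval_eq_sum_range, hdeg, Finset.sum_range_succ]
        simp only [zsmul_eq_mul, leadingCoeff, hdeg]
      have hid : ζ ^ i * ((P.leadingCoeff * y' 0 : ℤ) : ℝ)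
            - ((-∑ l ∈ Finset.range (d + 1), P.coeff l * y' (s + l) : ℤ) : ℝ)
          = ζ ^ s * (aeval ζ P * y' 0) - ∑ l ∈ Finset.range (d + 1),
            (P.coeff l : ℝ) * (ζ ^ (s + l) * y' 0 - y' (s + l)) := by
        rw [hV, his]
        push_cast
        simp only [mul_sub, Finset.sum_sub_distrib]
        have h1 : ∑ l ∈ Finset.range (d + 1), (P.coeff l : ℝ) * (ζ ^ (s + l) * y' 0)
            = ζ ^ s * ((∑ l ∈ Finset.range (d + 1), (P.coeff l : ℝ) * ζ ^ l) * y' 0) := by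
          rw [Finset.sum_mul, Finset.mul_sum]
          exact Finset.sum_congr rfl fun l _ => by ring
        rw [h1]; ring
      rw [hid]
      have h1 : |ζ ^ s * (aeval ζ P * y' 0)| ≤ Y := by
        rw [abs_mul, abs_mul, abs_pow]
        calc |ζ| ^ s * (|aeval ζ P| * |(y' 0 : ℝ)|)
            ≤ Z ^ n * (|aeval ζ P| * (H ^ n * |(y 0 : ℝ)|)) := by
              refine mul_le_mul ?_ (mul_le_mul_of_nonneg_left hx' (abs_nonneg _))
                (by positivity) (by positivity)
              exact (pow_le_pow_left₀ (abs_nonneg _) hζZ s).trans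
                (pow_le_pow_right₀ hZ (by omega))
          _ = |aeval ζ P| * Z ^ n * (H ^ n * |(y 0 : ℝ)|) := by ring
          _ ≤ Y := hP
      have h2 : |∑ l ∈ Finset.range (d + 1), (P.coeff l : ℝ) * (ζ ^ (s + l) * y' 0 - y' (s + l))|
          ≤ (d + 1) * (H * T) := by
        refine (Finset.abs_sum_le_sum_abs _ _).trans ?_
        refine (Finset.sum_le_card_nsmul _ _ (H * T) fun l hl => ?_).trans_eq (by simp)
        rw [abs_mul]
        have hl' := Finset.mem_range.1 hl
        exact mul_le_mul (abs_coeff_le_polyHeight P l) (he (s + l) (by omega)) (abs_nonneg _)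
          (by linarith)
      have h3 : Y ≤ H * T := hYT.trans (le_mul_of_one_le_left hT0 hH1)
      exact (abs_sub _ _).trans (by linarith)
    · push_cast
      rw [show ζ ^ i * ((P.leadingCoeff : ℝ) * y' 0) - P.leadingCoeff * y' i
        = P.leadingCoeff * (ζ ^ i * y' 0 - y' i) by ring, abs_mul]
      exact (mul_le_mul hlead (he i (by omega)) (abs_nonneg _) (by linarith)).trans hTT

/-- For a `U`-number of index `d + 1`, families of independent solutions of quality `1 / d` for the
powers up to `d`, available at every scale, give families of the same quality for the powers up to
any `n ≥ d`. -/
theorem IsUNumber.one_div_le_lambdaMinExponent {d : ℕ} (hd : 1 ≤ d) {ζ : ℝ}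
    (hζ : IsUNumber (d + 1) ζ) {n j : ℕ} (hn : d ≤ n)
    (h : ∀ δ : ℝ, 0 < δ → δ < 1 → ∃ C : ℝ, ∀ᶠ X : ℝ in atTop,
      ∃ v : Fin j → Fin (d + 1) → ℤ, LinearIndependent ℤ v ∧
      ∀ k, |(v k 0 : ℝ)| ≤ C * X ^ (1 + δ) ∧ ∀ i : Fin d,
        |ζ ^ ((i : ℕ) + 1) * (v k 0 : ℝ) - (v k i.succ : ℝ)| ≤ C * X ^ (-(1 / (d : ℝ) - δ))) :
    ((1 / (d : ℝ) : ℝ) : EReal) ≤ lambdaMinExponent n j ζ := by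
  rw [lambdaMinExponent_eq]
  refine le_sSup_coe_of_forall_lt fun μ hμ => ?_
  have hd0 : (0 : ℝ) < d := by positivity
  -- the parameters: `ν` is between `μ` and `1 / d`, and the scale is `X = H(P) ^ B`
  obtain ⟨ν, hν1, hν2⟩ := exists_between (max_lt hμ (by positivity : 0 < 1 / (d : ℝ)))
  have hμν : μ < ν := (le_max_left _ _).trans_lt hν1
  have hν0 : 0 < ν := (le_max_right _ _).trans_lt hν1
  set g : ℝ := 1 / d - ν with hg
  have hg0 : 0 < g := sub_pos.2 hν2
  obtain ⟨δ, hδ0, hδ⟩ := exists_between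
    (lt_min one_pos (by positivity : 0 < g / (2 * (1 + ν))))
  have hδ1 : δ < 1 := hδ.trans_le (min_le_left _ _)
  have hδg : δ * (2 * (1 + ν)) < g :=
    (lt_div_iff₀ (by positivity)).1 (hδ.trans_le (min_le_right _ _))
  set B : ℝ := (2 * (n * (1 + ν)) + 2) / g with hB
  have hB0 : 0 < B := by positivity
  have hBg : B * g = 2 * (n * (1 + ν)) + 2 := div_mul_cancel₀ _ hg0.ne'
  set α : ℝ := B * (1 + δ) + n with hα
  set β : ℝ := B * (1 / d - δ) - n with hβ
  have hα0 : 0 < α := by positivity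
  have hβα : ν * α < β := by
    have h1 : β - ν * α = B * g - B * (δ * (1 + ν)) - n * (1 + ν) := by
      rw [hα, hβ, hg]; ring
    nlinarith
  have hβ0 : 0 < β := (mul_pos hν0 hα0).trans hβα
  obtain ⟨C₀, hC₀⟩ := h δ hδ0 hδ1
  set C := max C₀ 1 with hC
  have hC1 : 1 ≤ C := le_max_right _ _
  set Z := max |ζ| 1 with hZ
  have hZ1 : 1 ≤ Z := le_max_right _ _
  refine mem_simulSet_of_frequently (C := (d + 2) ^ n * C) hα0 hβ0
    (hμν.trans ((lt_div_iff₀ hα0).2 hβα)) ?_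
  obtain ⟨H₀, hH₀⟩ := ((tendsto_rpow_atTop hB0).eventually hC₀).exists_forall_of_atTop
  rw [frequently_atTop]
  intro A
  -- with this `w`, the value `P(ζ)` is negligible against all factors in `exists_extension`
  set w : ℝ := n + B * (1 + δ) + B * (1 / d - δ) + 1 with hw
  obtain ⟨P, hP0, hPdeg, hPw, hPB⟩ := hζ.exists_natDegree_eq hd w
    ⌈max (max A H₀) (Z ^ n)⌉₊
  set H : ℝ := ((polyHeight P : ℕ) : ℝ) with hH
  have hHmax : max (max A H₀) (Z ^ n) ≤ H :=
    (Nat.le_ceil _).trans (by rw [hH]; exact_mod_cast hPB)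
  have hHA : A ≤ H := (le_max_left _ _).trans ((le_max_left _ _).trans hHmax)
  have hHH₀ : H₀ ≤ H := (le_max_right _ _).trans ((le_max_left _ _).trans hHmax)
  have hHZ : Z ^ n ≤ H := (le_max_right _ _).trans hHmax
  have hH1 : 1 ≤ H := one_le_polyHeight hP0
  have hHpos : 0 < H := by linarith
  refine ⟨H, hHA, ?_⟩
  obtain ⟨v, hli, hv⟩ := hH₀ H hHH₀
  set Y : ℝ := C * H ^ (-(B * (1 / d - δ))) with hY
  have hY0 : 0 < Y := by positivity
  have hx : ∀ k, |(v k 0 : ℝ)| ≤ C * H ^ (B * (1 + δ)) := fun k => by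
    refine (hv k).1.trans ?_
    rw [Real.rpow_mul hHpos.le]
    exact mul_le_mul_of_nonneg_right (le_max_left _ _) (by positivity)
  have hye : ∀ k, ∀ i ≤ d, |ζ ^ i * (v k (Fin.ofNat (d + 1) 0) : ℝ) - v k (Fin.ofNat (d + 1) i)|
      ≤ Y := by
    intro k i hi
    rcases Nat.eq_zero_or_pos i with rfl | hipos
    · simpa using hY0.le
    · have h1 := (hv k).2 ⟨i - 1, by omega⟩
      have h2 : (⟨i - 1, by omega⟩ : Fin d).succ = Fin.ofNat (d + 1) i := by
        ext
        simp [Fin.ofNat, Nat.mod_eq_of_lt (Nat.lt_succ_of_le hi)]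
        omega
      rw [h2] at h1
      simp only [Nat.sub_add_cancel hipos] at h1
      refine h1.trans ?_
      rw [hY, ← mul_neg, Real.rpow_mul hHpos.le]
      exact mul_le_mul_of_nonneg_right (le_max_left _ _) (by positivity)
  have hPY : ∀ k, |aeval ζ P| * Z ^ n * (H ^ n * |(v k (Fin.ofNat (d + 1) 0) : ℝ)|) ≤ Y := by
    intro k
    calc |aeval ζ P| * Z ^ n * (H ^ n * |(v k (Fin.ofNat (d + 1) 0) : ℝ)|)
        ≤ H ^ (-w) * H * (H ^ n * (C * H ^ (B * (1 + δ)))) := by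
          refine mul_le_mul (mul_le_mul hPw hHZ (by positivity) (by positivity))
            (mul_le_mul_of_nonneg_left (hx k) (by positivity)) (by positivity) (by positivity)
      _ = C * (H ^ (-w) * H ^ (1 : ℝ) * (H ^ (n : ℝ) * H ^ (B * (1 + δ)))) := by
          rw [Real.rpow_one, Real.rpow_natCast]; ring
      _ = Y := by
          rw [← Real.rpow_add hHpos, ← Real.rpow_add hHpos, ← Real.rpow_add hHpos, hY, hw]
          congr 2; ring
  choose y' hy' he using fun k => exists_extension hP0 hPdeg hZ1 (le_max_left _ _)
    (fun i => v k (Fin.ofNat (d + 1) i)) (hye k) (hPY k) (n - d) (Nat.sub_le _ _)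
  have hlead0 : P.leadingCoeff ^ (n - d) ≠ 0 := pow_ne_zero _ (leadingCoeff_ne_zero.2 hP0)
  have hlead : |(P.leadingCoeff : ℝ)| ≤ H := abs_coeff_le_polyHeight P _
  refine ⟨fun k i => y' k i, ?_, fun k => ⟨?_, fun i => ?_⟩⟩
  · have h1 : LinearIndependent ℤ fun k => P.leadingCoeff ^ (n - d) • v k :=
      hli.map' (LinearMap.lsmul ℤ (Fin (d + 1) → ℤ) (P.leadingCoeff ^ (n - d)))
        (LinearMap.ker_lsmul hlead0)
    refine LinearIndependent.of_comp
      (LinearMap.funLeft ℤ ℤ (Fin.castLE (by omega : d + 1 ≤ n + 1))) ?_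
    convert h1 using 1
    · funext k i
      have := hy' k i (by omega)
      simpa using this
    · exact Subsingleton.elim _ _
  · have h0 : y' k 0 = P.leadingCoeff ^ (n - d) * v k 0 := hy' k 0 (Nat.zero_le _)
    simp only [Fin.val_zero]
    rw [h0]
    push_cast
    rw [abs_mul, abs_pow]
    calc |(P.leadingCoeff : ℝ)| ^ (n - d) * |(v k 0 : ℝ)|
        ≤ H ^ n * (C * H ^ (B * (1 + δ))) := by
          refine mul_le_mul ?_ (hx k) (abs_nonneg _) (by positivity)
          exact (pow_le_pow_left₀ (abs_nonneg _) hlead _).trans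
            (pow_le_pow_right₀ hH1 (Nat.sub_le _ _))
      _ = 1 * C * H ^ α := by
          rw [hα, Real.rpow_add hHpos, Real.rpow_natCast]; ring
      _ ≤ (d + 2) ^ n * C * H ^ α := by
          gcongr
          exact one_le_pow₀ (by linarith)
  · have h1 := he k (i + 1) (by omega)
    simp only [Fin.val_zero, Fin.val_succ]
    refine h1.trans ?_
    calc ((d + 2) * H) ^ (n - d) * Y ≤ ((d + 2) * H) ^ n * Y := by
          refine mul_le_mul_of_nonneg_right (pow_le_pow_right₀ ?_ (Nat.sub_le _ _)) hY0.le
          nlinarith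
      _ = (d + 2) ^ n * C * H ^ (-β) := by
          rw [hY, hβ, show -(B * (1 / (d : ℝ) - δ) - n) = -(B * (1 / d - δ)) + n by ring,
            Real.rpow_add hHpos, Real.rpow_natCast, mul_pow]
          ring

/-! ### Squares of good approximations -/

/-- If `λ_2(ζ) > 1`, then `w_1(ζ) > 2`: a solution `(x, y₁, y₂)` of quality more than `1` satisfies
`x * y₂ = y₁ ^ 2`, so it is proportional to `(q ^ 2, q * p, p ^ 2)`, and `p / q` is a very good
approximation to `ζ`. -/
theorem five_halves_mem_wSet_one {ζ : ℝ} (hζ : Transcendental ℚ ζ) {lam : ℝ} (hlam : 1 < lam)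
    (h : lam ∈ simulSet 2 1 ζ) : (5 / 2 : ℝ) ∈ wSet 1 ζ := by
  set K : ℝ := |ζ| + 1 with hK
  have hK0 : 0 < K := by positivity
  refine mem_wSet_of_forall_exists hζ (C := K ^ (3 : ℝ)) (w₀ := 3) (by norm_num) fun δ hδ => ?_
  obtain ⟨X, ⟨hX1, hXδ, hXdet⟩, v, -, hv⟩ := (((eventually_ge_atTop (1 : ℝ)).and
    (((tendsto_rpow_atTop (by linarith : 0 < lam)).eventually_gt_atTop (1 / δ)).and
    ((tendsto_rpow_atTop (sub_pos.2 hlam)).eventually_gt_atTop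
      (2 + 2 * |ζ|)))).and_frequently h).exists
  obtain ⟨hx1, hxX, he⟩ := hv 0
  have hX : 0 < X := by linarith
  have he1 := he 0
  have he2 := he 1
  simp only [Fin.isValue, Fin.val_zero, zero_add, pow_one, Fin.succ_zero_eq_one, Fin.val_one,
    Fin.succ_one_eq_two, Nat.reduceAdd] at he1 he2
  set x : ℤ := v 0 0 with hx
  set y₁ : ℤ := v 0 1 with hy₁
  set y₂ : ℤ := v 0 2 with hy₂
  set E : ℝ := X ^ (-lam) with hE
  have hE0 : 0 < E := Real.rpow_pos_of_pos hX _
  have hE1 : E ≤ 1 := Real.rpow_le_one_of_one_le_of_nonpos hX1 (by linarith)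
  have hEX : X * E * X ^ (lam - 1) = 1 := by
    rw [hE]
    nth_rewrite 1 [← Real.rpow_one X]
    rw [← Real.rpow_add hX, ← Real.rpow_add hX, show 1 + -lam + (lam - 1) = 0 by ring,
      Real.rpow_zero]
  have hsmall : (2 + 2 * |ζ|) * (X * E) < 1 := by
    rw [← hEX, mul_comm]
    exact mul_lt_mul_of_pos_left hXdet (by positivity)
  -- the integer `x * y₂ - y₁ ^ 2` is of order `X ^ (1 - lam)`, hence zero
  have hdet : x * y₂ = y₁ ^ 2 := by
    set e₁ : ℝ := ζ * x - y₁ with he₁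
    set e₂ : ℝ := ζ ^ 2 * x - y₂ with he₂
    have hid : ((x * y₂ - y₁ ^ 2 : ℤ) : ℝ) = -(x * e₂) + 2 * (ζ * (x * e₁)) - e₁ * e₁ := by
      push_cast
      rw [he₁, he₂]; ring
    have h1 : |((x * y₂ - y₁ ^ 2 : ℤ) : ℝ)| < 1 := by
      rw [hid]
      have hxe : ∀ e : ℝ, |e| ≤ E → |(x : ℝ) * e| ≤ X * E := fun e hee => by
        rw [abs_mul]
        exact mul_le_mul hxX hee (abs_nonneg _) hX.le
      have a1 := abs_sub (-(x * e₂) + 2 * (ζ * (x * e₁))) (e₁ * e₁)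
      have a2 := abs_add_le (-(x * e₂)) (2 * (ζ * (x * e₁)))
      have a3 : |2 * (ζ * (x * e₁))| ≤ 2 * (|ζ| * (X * E)) := by
        rw [abs_mul, abs_mul, abs_two]
        exact mul_le_mul_of_nonneg_left
          (mul_le_mul_of_nonneg_left (hxe _ he1) (abs_nonneg _)) (by norm_num)
      have a4 : |e₁ * e₁| ≤ X * E := by
        rw [abs_mul]
        exact mul_le_mul (he1.trans (hE1.trans hX1)) he1 (abs_nonneg _) hX.le
      have a5 := hxe _ he2
      rw [abs_neg] at a2
      nlinarith
    rw [← Int.cast_abs] at h1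
    have := Int.abs_lt_one_iff.1 (by exact_mod_cast h1)
    linarith
  have hx0 : x ≠ 0 := by
    intro h0
    rw [h0] at hx1
    norm_num at hx1
  obtain ⟨g, q, p, hg, hcop, hxg, hyg⟩ : ∃ g q p : ℤ, g ≠ 0 ∧ IsCoprime q p ∧ x = q * g ∧
      y₁ = p * g := by
    have hgpos : 0 < Int.gcd x y₁ := Int.gcd_pos_of_ne_zero_left _ hx0
    obtain ⟨q, p, hc, h1, h2⟩ := Int.exists_gcd_one hgpos
    exact ⟨Int.gcd x y₁, q, p, by exact_mod_cast hgpos.ne', Int.isCoprime_iff_gcd_eq_one.2 hc,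
      h1, h2⟩
  have hq0 : q ≠ 0 := by
    rintro rfl
    exact hx0 (by rw [hxg, zero_mul])
  have hqg : q ∣ g := by
    have h1 : q * y₂ = p ^ 2 * g := by
      have : g * (q * y₂) = g * (p ^ 2 * g) := by
        rw [hxg, hyg] at hdet
        linear_combination hdet
      exact mul_left_cancel₀ hg this
    exact (hcop.pow_right (n := 2)).dvd_of_dvd_mul_left ⟨y₂, h1.symm⟩
  have hqgabs : |(q : ℝ)| ≤ |(g : ℝ)| := by
    have := Int.le_of_dvd (abs_pos.2 hg) ((abs_dvd_abs q g).2 hqg)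
    exact_mod_cast this
  have hq1 : 1 ≤ |(q : ℝ)| := by
    rw [← Int.cast_abs]
    exact_mod_cast Int.one_le_abs hq0
  set Q : ℝ := |(q : ℝ)| with hQ
  have hQ0 : 0 < Q := by linarith
  have hval : |ζ * q - p| * |(g : ℝ)| ≤ E := by
    rw [← abs_mul]
    have : (ζ * q - p) * g = ζ * x - y₁ := by rw [hxg, hyg]; push_cast; ring
    rwa [this]
  have hvalQ : |ζ * q - p| * Q ≤ E :=
    (mul_le_mul_of_nonneg_left hqgabs (abs_nonneg _)).trans hval
  have hvalE : |ζ * q - p| ≤ E := (le_mul_of_one_le_right (abs_nonneg _) hq1).trans hvalQ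
  have hEQ : E ≤ Q ^ (-(2 : ℝ)) := by
    have hQX : Q ^ (2 : ℝ) ≤ X := by
      refine le_trans ?_ hxX
      rw [hxg]
      push_cast
      rw [abs_mul, Real.rpow_two, sq]
      exact mul_le_mul_of_nonneg_left hqgabs hQ0.le
    calc E ≤ X ^ (-(1 : ℝ)) := Real.rpow_le_rpow_of_exponent_le hX1 (by linarith)
      _ ≤ (Q ^ (2 : ℝ)) ^ (-(1 : ℝ)) :=
        Real.rpow_le_rpow_of_nonpos (by positivity) hQX (by norm_num)
      _ = Q ^ (-(2 : ℝ)) := by rw [← Real.rpow_mul hQ0.le]; norm_num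
  have hval3 : |ζ * q - p| ≤ Q ^ (-(3 : ℝ)) := by
    rw [show -(3 : ℝ) = -2 - 1 by norm_num, Real.rpow_sub hQ0, Real.rpow_one, le_div_iff₀ hQ0]
    exact hvalQ.trans hEQ
  set a : Fin 2 → ℤ := ![-p, q] with ha
  have ha0 : a ≠ 0 := fun h0 => hq0 (by simpa [ha] using congrFun h0 1)
  have haev : aeval ζ (Polynomial.ofFn 2 a) = ζ * q - p := by
    rw [aeval_ofFn 1, Fin.sum_univ_two]
    simp [ha]; ring
  have hheight : (polyHeight (Polynomial.ofFn 2 a) : ℝ) ≤ K * Q := by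
    refine polyHeight_ofFn_le ha0 fun i => ?_
    have hp : |(p : ℝ)| ≤ K * Q := by
      have h1 := abs_sub (ζ * q) (ζ * q - p)
      rw [sub_sub_cancel, abs_mul] at h1
      rw [hK]
      nlinarith
    fin_cases i
    · simpa [ha] using hp
    · have : |ζ| * Q ≥ 0 := by positivity
      simp only [ha, Fin.mk_one, Matrix.cons_val_one, Matrix.cons_val_fin_one]
      rw [hK]; nlinarith
  have hHpos : (0 : ℝ) < polyHeight (Polynomial.ofFn 2 a) := by
    linarith [one_le_polyHeight (ofFn_ne_zero ha0)]
  refine ⟨Polynomial.ofFn 2 a, ofFn_ne_zero ha0, natDegree_ofFn_le 1 a, ?_, ?_⟩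
  · rw [haev]
    refine hvalE.trans_lt ?_
    rw [hE, Real.rpow_neg hX.le, inv_lt_comm₀ (by positivity) hδ, ← one_div]
    exact hXδ
  · rw [haev]
    refine hval3.trans ?_
    rw [Real.rpow_neg hQ0.le, Real.rpow_neg hHpos.le, ← div_eq_mul_inv, ← one_div,
      div_le_div_iff₀ (by positivity) (by positivity), one_mul, ← Real.mul_rpow hK0.le hQ0.le]
    exact Real.rpow_le_rpow hHpos.le hheight (by norm_num)

/-! ### The exponents of a `U`-number -/

theorem lambdaExponent_two_le_one {ζ : ℝ} (hζ : Transcendental ℚ ζ) (h : wExponent 1 ζ ≤ 2) :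
    lambdaExponent 2 ζ ≤ ((1 : ℝ) : EReal) := by
  by_contra hlt
  rw [not_le, lambdaExponent_eq, lambdaMinExponent_eq] at hlt
  obtain ⟨lam, hlam, hlt⟩ := exists_mem_of_lt_sSup_coe hlt
  have hmem := five_halves_mem_wSet_one hζ (EReal.coe_lt_coe_iff.1 hlt) hlam
  have h1 : ((5 / 2 : ℝ) : EReal) ≤ ((2 : ℝ) : EReal) :=
    (le_sSup (Set.mem_image_of_mem _ hmem)).trans h
  have := EReal.coe_le_coe_iff.1 h1
  norm_num at this

theorem IsUNumber.one_div_le_lambdaExponent {d : ℕ} (hd : 1 ≤ d) {ζ : ℝ}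
    (hζ : IsUNumber (d + 1) ζ) {n : ℕ} (hn : 1 ≤ n) :
    ((1 / (d : ℝ) : ℝ) : EReal) ≤ lambdaExponent n ζ := by
  rcases le_total n d with hnd | hdn
  · refine le_trans ?_ (_root_.one_div_le_lambdaExponent hn ζ)
    rw [EReal.coe_le_coe_iff]
    exact one_div_le_one_div_of_le (by positivity) (by exact_mod_cast hnd)
  · rw [lambdaExponent_eq]
    refine hζ.one_div_le_lambdaMinExponent hd hdn fun δ hδ0 hδ1 => ⟨2, ?_⟩
    filter_upwards [eventually_ge_atTop 1] with X hX
    obtain ⟨z, hz, h0, hi⟩ := exists_dirichlet_simultaneous hd ζ hX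
    refine ⟨fun _ => z, linearIndependent_const_of_ne_zero hz, fun _ => ⟨h0.trans ?_,
      fun i => (hi i).trans ?_⟩⟩
    · have : X ≤ X ^ (1 + δ) := Real.self_le_rpow_of_one_le hX (by linarith)
      linarith
    · have h1 : X ^ (-(1 / (d : ℝ))) ≤ X ^ (-(1 / (d : ℝ) - δ)) :=
        Real.rpow_le_rpow_of_exponent_le hX (by linarith)
      linarith [Real.rpow_nonneg (zero_le_one.trans hX) (-(1 / (d : ℝ)))]

theorem IsUNumber.lambdaExponent_eq_of_le {d : ℕ} (hd : 1 ≤ d) {ζ : ℝ}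
    (hζ : IsUNumber (d + 1) ζ) {k n : ℕ} (hn : 1 ≤ n) (hkn : k ≤ n)
    (h : lambdaExponent k ζ ≤ ((1 / (d : ℝ) : ℝ) : EReal)) :
    lambdaExponent n ζ = ((1 / (d : ℝ) : ℝ) : EReal) :=
  ((lambdaExponent_anti hkn ζ).trans h).antisymm (hζ.one_div_le_lambdaExponent hd hn)

theorem IsUNumber.wExponent_eq_iff_lambdaMinExponent {d : ℕ} (hd : 1 ≤ d) {ζ : ℝ}
    (hζ : IsUNumber (d + 1) ζ) : wExponent d ζ = ((d : ℝ) : EReal) ↔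
      ∀ n : ℕ, d ≤ n → lambdaExponent n ζ = ((1 / (d : ℝ) : ℝ) : EReal) ∧
        ∀ j : ℕ, 2 ≤ j → j ≤ d + 1 →
          lambdaMinExponent n j ζ = ((1 / (d : ℝ) : ℝ) : EReal) := by
  rw [wExponent_eq_iff hd hζ.transcendental]
  refine ⟨fun h n hn => ?_, fun h => (h d le_rfl).1⟩
  have hlam := hζ.lambdaExponent_eq_of_le hd (hd.trans hn) hn h.le
  refine ⟨hlam, fun j hj2 hjd => le_antisymm ?_ ?_⟩
  · exact (lambdaMinExponent_le_lambdaExponent n (by omega) ζ).trans hlam.le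
  · refine hζ.one_div_le_lambdaMinExponent hd hn fun δ hδ0 hδ1 => ?_
    obtain ⟨C, hC⟩ := exists_linearIndependent_of_lambdaExponent_le hd h.le hδ0 hδ1
    refine ⟨C, hC.mono ?_⟩
    rintro X ⟨v, hli, hv⟩
    exact ⟨fun k => v (Fin.castLE hjd k), hli.comp _ (Fin.castLE_injective hjd), fun k => hv _⟩

theorem theorem3p3 (m : ℕ) (hm : 2 ≤ m) (ζ : ℝ) (hζ : IsUNumber m ζ) :
    -- the lower bound
    (∀ n : ℕ, 1 ≤ n → ((1 / ((m : ℝ) - 1) : ℝ) : EReal) ≤ lambdaExponent n ζ) ∧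
    -- the characterization of `w_{m-1}(ζ) = m - 1`
    (wExponent (m - 1) ζ = (((m : ℝ) - 1 : ℝ) : EReal) ↔
      ∀ n : ℕ, m - 1 ≤ n →
        lambdaExponent n ζ = ((1 / ((m : ℝ) - 1) : ℝ) : EReal) ∧
        ∀ j : ℕ, 2 ≤ j → j ≤ m →
          lambdaMinExponent n j ζ = ((1 / ((m : ℝ) - 1) : ℝ) : EReal)) ∧
    -- the characterization of the explicit sequence; for `m = 2` only for `w` in `[1, 2]`
    (∀ w : EReal, (3 ≤ m ∨ (1 ≤ w ∧ w ≤ 2)) →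
      ((wExponent 1 ζ = w ∧ 1 ≤ w ∧ w ≤ 2 ∧
          ∀ t : ℕ, 2 ≤ t → t ≤ m - 1 → wExponent t ζ = ((t : ℝ) : EReal)) ↔
        (lambdaExponent 1 ζ = w ∧
          (∀ n : ℕ, 2 ≤ n → n ≤ m - 1 → lambdaExponent n ζ = ((1 / (n : ℝ) : ℝ) : EReal)) ∧
          (∀ n : ℕ, 2 ≤ n → m - 1 ≤ n →
            lambdaExponent n ζ = ((1 / ((m : ℝ) - 1) : ℝ) : EReal))))) := by
  obtain ⟨d, rfl⟩ : ∃ d, m = d + 1 := ⟨m - 1, by omega⟩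
  have hd : 1 ≤ d := by omega
  have htr := hζ.transcendental
  have hcast : ((d + 1 : ℕ) : ℝ) - 1 = d := by push_cast; ring
  rw [hcast, Nat.add_sub_cancel]
  refine ⟨fun n hn => hζ.one_div_le_lambdaExponent hd hn,
    hζ.wExponent_eq_iff_lambdaMinExponent hd, fun w hw => ?_⟩
  rw [lambdaExponent_one htr]
  have hiff : ∀ t : ℕ, 2 ≤ t → (wExponent t ζ = ((t : ℝ) : EReal) ↔
      lambdaExponent t ζ = ((1 / (t : ℝ) : ℝ) : EReal)) :=
    fun t ht => wExponent_eq_iff (by omega) htr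
  constructor
  · rintro ⟨rfl, -, hw2, ht⟩
    refine ⟨rfl, fun n hn2 hnd => (hiff n hn2).1 (ht n hn2 hnd), fun n hn2 hdn => ?_⟩
    rcases hd.eq_or_lt with rfl | hd2
    · refine hζ.lambdaExponent_eq_of_le le_rfl (by omega) hn2 ?_
      simpa using lambdaExponent_two_le_one htr hw2
    · exact hζ.lambdaExponent_eq_of_le hd (by omega) hdn ((hiff d hd2).1 (ht d hd2 le_rfl)).le
  · rintro ⟨rfl, hlam, -⟩
    have ht : ∀ t : ℕ, 2 ≤ t → t ≤ d → wExponent t ζ = ((t : ℝ) : EReal) :=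
      fun t ht2 htd => (hiff t ht2).2 (hlam t ht2 htd)
    refine ⟨rfl, ?_, ?_, ht⟩
    · simpa using le_wExponent le_rfl htr
    · rcases hw with h3 | h12
      · -- for `m ≥ 3` the bound `w ≤ 2` follows from `w_1(ζ) ≤ w_2(ζ) = 2`
        exact (wExponent_mono one_le_two ζ).trans_eq 
          ((ht 2 le_rfl (by omega)).trans (by rw [Nat.cast_ofNat]; rfl))
      · exact h12.2
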